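/- Let $A$ be a (not necessarily unital) C*-algebra and let $H$ be a complex Hilbert space which strictly contains a copy of every cyclic representation of $A$; that is, for every representation of $A$ on a Hilbert space $K$ with a cyclic vector there is a linear isometry of $K$ onto a proper subspace of $H$. Let $\mathrm{rep}(A:H)$ be the set of all (possibly degenerate) $*$-representations $\pi : A \to B(H)$, with the topology of pointwise convergence on $A$ with respect to the weak operator topology (WOT) of $B(H)$. Let $\mathcal F$ be the set of all maps $T : \mathrm{rep}(A:H) \to B(H)$ such that 1. $T$ is continuous for the WOT on $B(H)$; 2. $T$ is compatible with intertwiners that are partial isometries: if $\pi_1, \pi_2 \in \mathrm{rep}(A:H)$ and $S \in B(H)$ is a partial isometry with $S\pi_1(a) = \pi_2(a)S$ for all $a \in A$, then $S\,T(\pi_1) = T(\pi_2)\,S$; 3. $T(0) = 0$, where the argument $0$ is the zero representation. Then $\mathcal F$ is a $*$-algebra under the pointwise operations, and the map sending $a \in A$ to $(\pi \mapsto \pi(a))$ is a $*$-isomorphism from $A$ onto $\mathcal F$, isometric for the norm $\|T\| = \sup_{\pi} \|T(\pi)\|$ on $\mathcal F$. In particular every $T \in \mathcal F$ is bounded, although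 boundedness is not assumed. -/

import Mathlib

universe u v

/-- `CStarRep A H`: the possibly degenerate representations of `A` on `H`, i.e. the `*`-algebra
morphisms from `A` to the bounded operators on `H`. -/
abbrev CStarRep (A H : Type*) [NonUnitalCStarAlgebra A] [NormedAddCommGroup H]
    [InnerProductSpace ℂ H] [CompleteSpace H] : Type _ :=
  A →⋆ₙₐ[ℂ] (H →L[ℂ] H)

/-- The topology of pointwise convergence on `CStarRep A H`, with respect to the weak operator topology
on the bounded operators. -/
noncomputable instance CStarRep.instTopologicalSpace (A H : Type*) [NonUnitalCStarAlgebra A] [NormedAddCommGroup H]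
    [InnerProductSpace ℂ H] [CompleteSpace H] : TopologicalSpace (CStarRep A H) :=
  TopologicalSpace.induced
    (fun (π : CStarRep A H) (a : A) => (ContinuousLinearMapWOT.ofCLM (π a) : H →WOT[ℂ] H))
    Pi.topologicalSpace

/-- The vector `ζ` is cyclic for the representation `σ`: the vectors `σ a ζ` are dense. -/
def CStarRep.IsCyclicVector {A K : Type*} [NonUnitalCStarAlgebra A] [NormedAddCommGroup K]
    [InnerProductSpace ℂ K] [CompleteSpace K] (σ : CStarRep A K) (ζ : K) : Prop :=
  Dense (Set.range fun a : A => σ a ζ)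

/-- `H` strictly contains a copy of (the space of) every cyclic representation of `A`: each such
space embeds isometrically onto a proper subspace of `H`. A cyclic representation is unitarily
equivalent to a GNS representation, whose space can be formed in the universe of `A`; hence it
suffices to let `K` range over that universe. -/
def StrictlyContainsCyclicReps (A : Type u) (H : Type v) [NonUnitalCStarAlgebra A]
    [NormedAddCommGroup H] [InnerProductSpace ℂ H] [CompleteSpace H] : Prop :=
  ∀ (K : Type u) [NormedAddCommGroup K] [InnerProductSpace ℂ K] [CompleteSpace K]
    (σ : CStarRep A K) (ζ : K), σ.IsCyclicVector ζ →
      ∃ V : K →ₗᵢ[ℂ] H, ¬ Function.Surjective V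

/-- `S` is a partial isometry. -/
def IsPartialIsometry {H : Type*} [NormedAddCommGroup H] [InnerProductSpace ℂ H]
    [CompleteSpace H] (S : H →L[ℂ] H) : Prop :=
  S * star S * S = S

/-- `S` is an intertwiner from `π₁` to `π₂`. -/
def CStarRep.Intertwines {A H : Type*} [NonUnitalCStarAlgebra A] [NormedAddCommGroup H]
    [InnerProductSpace ℂ H] [CompleteSpace H] (S : H →L[ℂ] H) (π₁ π₂ : CStarRep A H) : Prop :=
  ∀ a : A, S * π₁ a = π₂ a * S

/-- The maps `T` from `CStarRep A H` to the bounded operators on `H` which are continuous for the weak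
operator topology, compatible with the intertwiners that are partial isometries, and vanish at the
zero representation. No boundedness is required. -/
structure IsContinuousField {A H : Type*} [NonUnitalCStarAlgebra A] [NormedAddCommGroup H]
    [InnerProductSpace ℂ H] [CompleteSpace H] (T : CStarRep A H → (H →L[ℂ] H)) : Prop where
  continuous_wot :
    Continuous fun π : CStarRep A H => (ContinuousLinearMapWOT.ofCLM (T π) : H →WOT[ℂ] H)
  compatible : ∀ (π₁ π₂ : CStarRep A H) (S : H →L[ℂ] H), IsPartialIsometry S →
    CStarRep.Intertwines S π₁ π₂ → S * T π₁ = T π₂ * S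
  map_zero : T 0 = 0

/-! A field `T` is determined by its quadratic forms `⟪x, T π x⟫`, and the point is to view these as
a function on the quasi-state space `Q` of `A`, which is convex and weak* compact.

If `(π, x)` and `(ρ, y)` have the same vector functional, the canonical map `π a x ↦ ρ a y` is a
partial isometry, so compatibility makes `⟪x, T π x⟫` a function of the functional alone
(`inner_eq_of_realizes`). Compatibility with unitaries makes `T π` commute with the commutant of
`π`. If `φ = φ₁ + φ₂`, the Radon-Nikodym operators of the summands lie in that commutant and sum to
the identity on the cyclic subspace, so the function is affine (`inner_add_of_realizes`). It
vanishes at `0`. By GNS and the size of `H`, it is computed on all of `Q` by representations on `H`.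

The delicate point is weak* continuity, since `T` is continuous only in `π`. If `H` is
finite-dimensional, realizing pairs `(π, x)` have limits along ultrafilters. If `H` is
infinite-dimensional, `eventually_exists_realizes` shows that functionals near `φ₀` are realized by
the same vector `z` in representations near `π₀`: a finite-dimensional compression of `π₀` is copied
to a representation of the nearby functional by a contraction, which is then dilated to an isometry.

Kadison's function representation (`exists_apply_eq_of_affine`) identifies the real continuous
affine functions on `Q` vanishing at `0` with evaluations at selfadjoint elements of `A`. Applied to
the real and imaginary parts of `T`, it gives `a` with `T π = π a`. Boundedness is a consequence,
because continuity is only tested on the compact set `Q`. Isometry holds because quasi-states attain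
the norms of selfadjoint elements. -/

section

open scoped InnerProductSpace
open ContinuousLinearMap

/-! ### Matrix coefficients, operations on fields, and the commutant -/

section Basics

variable {A H K : Type*} [NonUnitalCStarAlgebra A]
  [NormedAddCommGroup H] [InnerProductSpace ℂ H] [CompleteSpace H]
  [NormedAddCommGroup K] [InnerProductSpace ℂ K] [CompleteSpace K]

namespace CStarRep

lemma inner_apply_left (π : CStarRep A H) (a : A) (x y : H) :
    ⟪π a x, y⟫_ℂ = ⟪x, π (star a) y⟫_ℂ := by
  rw [map_star, star_eq_adjoint, adjoint_inner_right]

lemma inner_apply_right (π : CStarRep A H) (a : A) (x y : H) :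
    ⟪x, π a y⟫_ℂ = ⟪π (star a) x, y⟫_ℂ := by
  rw [inner_apply_left, star_star]

lemma adjoint_isometry_apply (V : K →ₗᵢ[ℂ] H) (k : K) :
    adjoint V.toContinuousLinearMap (V k) = k := by
  have := V.adjoint_comp_self
  exact congr($this k)

/-- Transport of a representation along a linear isometry `V`; it vanishes on the orthogonal
complement of the range of `V`. -/
noncomputable def conjIsometry (V : K →ₗᵢ[ℂ] H) (σ : CStarRep A K) : CStarRep A H where
  toFun a := V.toContinuousLinearMap ∘L σ a ∘L adjoint V.toContinuousLinearMap
  map_smul' c a := by ext; simp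
  map_zero' := by ext; simp
  map_add' a b := by ext; simp
  map_mul' a b := by
    ext x
    simp [adjoint_isometry_apply]
  map_star' a := by
    rw [map_star]
    simp [star_eq_adjoint, adjoint_comp, ContinuousLinearMap.comp_assoc]

@[simp]
lemma conjIsometry_apply (V : K →ₗᵢ[ℂ] H) (σ : CStarRep A K) (a : A) (x : H) :
    conjIsometry V σ a x = V (σ a (adjoint V.toContinuousLinearMap x)) := rfl

lemma inner_conjIsometry (V : K →ₗᵢ[ℂ] H) (σ : CStarRep A K) (a : A) (x y : H) :
    ⟪y, conjIsometry V σ a x⟫_ℂ =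
      ⟪adjoint V.toContinuousLinearMap y, σ a (adjoint V.toContinuousLinearMap x)⟫_ℂ := by
  rw [adjoint_inner_left]; rfl

/-- The topology on representations is the one induced by the matrix coefficients. -/
lemma isInducing_coeff :
    Topology.IsInducing fun (π : CStarRep A H) (t : A × H × H) => ⟪t.2.2, π t.1 t.2.1⟫_ℂ := by
  rw [Topology.isInducing_iff_nhds]
  intro π
  have h1 : Topology.IsInducing (fun (π : CStarRep A H) (a : A) =>
      (ContinuousLinearMapWOT.ofCLM (π a) : H →WOT[ℂ] H)) := ⟨rfl⟩
  apply le_antisymm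
  · rw [← Filter.map_le_iff_le_comap]
    refine tendsto_pi_nhds.2 fun t => ?_
    have h2 := (tendsto_pi_nhds.1 (h1.continuous.tendsto π)) t.1
    rw [ContinuousLinearMapWOT.tendsto_iff_forall_dual_apply_tendsto] at h2
    exact h2 t.2.1 (InnerProductSpace.toDual ℂ H t.2.2)
  · rw [h1.nhds_eq_comap, ← Filter.map_le_iff_le_comap]
    refine tendsto_pi_nhds.2 fun a => ?_
    rw [ContinuousLinearMapWOT.tendsto_iff_forall_dual_apply_tendsto]
    intro x y
    have h3 := (tendsto_pi_nhds.1 (Filter.tendsto_comap (x := nhds fun t : A × H × H =>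
      ⟪t.2.2, π t.1 t.2.1⟫_ℂ) (f := fun (π : CStarRep A H) (t : A × H × H) =>
        ⟪t.2.2, π t.1 t.2.1⟫_ℂ))) (a, x, (InnerProductSpace.toDual ℂ H).symm y)
    simpa using h3

end CStarRep

open CStarRep

lemma IsContinuousField.continuous_inner {T : CStarRep A H → (H →L[ℂ] H)}
    (hT : IsContinuousField T) (x y : H) : Continuous fun π => ⟪y, T π x⟫_ℂ :=
  (ContinuousLinearMapWOT.continuous_dual_apply x (InnerProductSpace.toDual ℂ H y)).comp
    hT.continuous_wot

lemma isContinuousField_of_continuous_inner {T : CStarRep A H → (H →L[ℂ] H)}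
    (h : ∀ x y : H, Continuous fun π => ⟪y, T π x⟫_ℂ)
    (hc : ∀ (π₁ π₂ : CStarRep A H) (S : H →L[ℂ] H), IsPartialIsometry S →
      CStarRep.Intertwines S π₁ π₂ → S * T π₁ = T π₂ * S) (h0 : T 0 = 0) :
    IsContinuousField T where
  continuous_wot := ContinuousLinearMapWOT.continuous_of_dual_apply_continuous fun x y => by
    simpa using h x ((InnerProductSpace.toDual ℂ H).symm y)
  compatible := hc
  map_zero := h0

lemma IsPartialIsometry.adjoint {S : H →L[ℂ] H} (hS : IsPartialIsometry S) :
    IsPartialIsometry (star S) := by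
  have := congr(star $hS)
  simpa [IsPartialIsometry, mul_assoc] using this

lemma CStarRep.Intertwines.adjoint {S : H →L[ℂ] H} {π₁ π₂ : CStarRep A H}
    (hS : Intertwines S π₁ π₂) : Intertwines (star S) π₂ π₁ := fun a => by
  have := congr(star $(hS (star a)))
  simpa [map_star] using this.symm

namespace IsContinuousField

variable {T T₁ T₂ : CStarRep A H → (H →L[ℂ] H)}

lemma eval (a : A) : IsContinuousField fun π : CStarRep A H => π a :=
  isContinuousField_of_continuous_inner
    (fun x y => (continuous_pi_iff.1 isInducing_coeff.continuous) (a, x, y))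
    (fun _ _ _ _ h => h a) rfl

protected lemma star (hT : IsContinuousField T) : IsContinuousField fun π => star (T π) := by
  refine isContinuousField_of_continuous_inner (fun x y => ?_) (fun π₁ π₂ S hS hi => ?_) ?_
  · have := Complex.continuous_conj.comp (hT.continuous_inner y x)
    refine this.congr fun π => ?_
    simp [star_eq_adjoint, adjoint_inner_right]
  · have := congr(star $(hT.compatible _ _ _ hS.adjoint hi.adjoint))
    simpa using this.symm
  · simp [hT.map_zero]

protected lemma add (h₁ : IsContinuousField T₁) (h₂ : IsContinuousField T₂) :
    IsContinuousField fun π => T₁ π + T₂ π := by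
  refine isContinuousField_of_continuous_inner (fun x y => ?_) (fun π₁ π₂ S hS hi => ?_) ?_
  · exact ((h₁.continuous_inner x y).add (h₂.continuous_inner x y)).congr fun π => by
      simp
  · rw [mul_add, add_mul, h₁.compatible _ _ _ hS hi, h₂.compatible _ _ _ hS hi]
  · simp [h₁.map_zero, h₂.map_zero]

protected lemma smul (hT : IsContinuousField T) (c : ℂ) :
    IsContinuousField fun π => c • T π := by
  refine isContinuousField_of_continuous_inner (fun x y => ?_) (fun π₁ π₂ S hS hi => ?_) ?_
  · exact ((continuous_const_smul c).comp (hT.continuous_inner x y)).congr fun π => by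
      simp
  · rw [mul_smul_comm, smul_mul_assoc, hT.compatible _ _ _ hS hi]
  · simp [hT.map_zero]

/-- A continuous field vanishes on the vectors on which the representation is degenerate. -/
lemma apply_eq_zero (hT : IsContinuousField T) {π : CStarRep A H} {y : H}
    (hy : ∀ a, π a y = 0) : T π y = 0 := by
  let N : Submodule ℂ H := ⨅ a, (π a).ker
  have hN : IsClosed (N : Set H) := by
    simp only [N, Submodule.coe_iInf]
    exact isClosed_iInter fun a => (π a).isClosed_ker
  have : CompleteSpace N := hN.completeSpace_coe
  have hmem : y ∈ N := by simpa [N] using hy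
  have hP := isStarProjection_starProjection (U := N)
  -- The projection onto the degenerate subspace intertwines `0` with `π`, which is where the
  -- condition `T 0 = 0` enters.
  have h := hT.compatible 0 π N.starProjection
    (by rw [IsPartialIsometry, hP.isSelfAdjoint.star_eq, hP.isIdempotentElem, hP.isIdempotentElem])
    (fun a => by
      ext x
      have : N.starProjection x ∈ N := Submodule.starProjection_apply_mem _ _
      have : π a (N.starProjection x) = 0 := by
        simp only [N, Submodule.mem_iInf] at this
        exact this a
      simp [this])
  have h' := congr($h y)
  simpa [hT.map_zero, Submodule.starProjection_eq_self_iff.2 hmem] using h'.symm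

lemma commute_unitary (hT : IsContinuousField T) {π : CStarRep A H} {u : H →L[ℂ] H}
    (hu : u ∈ unitary (H →L[ℂ] H)) (h : ∀ a, Commute u (π a)) : Commute u (T π) :=
  hT.compatible π π u
    (by rw [IsPartialIsometry, mul_assoc, Unitary.star_mul_self_of_mem hu, mul_one]) h

/-- The value of a continuous field at `π` commutes with the commutant of `π`. -/
lemma commute_selfAdjoint (hT : IsContinuousField T) {π : CStarRep A H} {h : H →L[ℂ] H}
    (hh : IsSelfAdjoint h) (hc : ∀ a, Commute h (π a)) : Commute h (T π) := by
  obtain rfl | h0 := eq_or_ne h 0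
  · exact Commute.zero_left _
  set g : H →L[ℂ] H := ((‖h‖⁻¹ : ℝ) : ℂ) • h with hg
  have hgs : IsSelfAdjoint g := by
    rw [isSelfAdjoint_iff, hg, star_smul, hh.star_eq]; simp
  have hgn : ‖g‖ ≤ 1 := by
    rw [hg, norm_smul]; simp [inv_mul_cancel₀ (norm_ne_zero_iff.2 h0)]
  have hgc : ∀ a, Commute g (π a) := fun a => (hc a).smul_left _
  set r := CFC.sqrt (1 - g ^ 2)
  -- A selfadjoint contraction `g` is the mean of the unitary `g + i√(1 - g²)` and its adjoint, both
  -- in the commutant of `π`; compatibility applies to unitaries.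
  have hu := hgs.self_add_I_smul_cfcSqrt_sub_sq_mem_unitary g hgn
  have hrc : ∀ a, Commute r (π a) := fun a =>
    (((Commute.one_left _).sub_left ((hgc a).pow_left 2))).cfcₙ_nnreal _
  have hr : IsSelfAdjoint r := (CFC.sqrt_nonneg (1 - g ^ 2)).isSelfAdjoint
  have hus : star (g + Complex.I • r) = g - Complex.I • r := by
    simp [hgs.star_eq, hr.star_eq, sub_eq_add_neg]
  have h1 : Commute (g + Complex.I • r) (T π) :=
    hT.commute_unitary hu fun a => (hgc a).add_left ((hrc a).smul_left _)
  have h2 : Commute (g - Complex.I • r) (T π) := by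
    rw [← hus]
    refine hT.commute_unitary (Unitary.star_mem hu) fun a => ?_
    rw [hus]
    exact (hgc a).sub_left ((hrc a).smul_left _)
  have h3 := (h1.add_left h2).smul_left ((2⁻¹ : ℂ) * ‖h‖)
  have h4 : (‖h‖ : ℂ) ≠ 0 := by simpa using h0
  have h5 : g + Complex.I • r + (g - Complex.I • r) = (2 : ℂ) • g := by module
  rwa [h5, hg, smul_smul, smul_smul,
    show (2⁻¹ : ℂ) * ‖h‖ * 2 * ((‖h‖⁻¹ : ℝ) : ℂ) = 1 by push_cast; field_simp, one_smul] at h3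

end IsContinuousField
end Basics

/-! ### Dependence of the quadratic forms on vector functionals -/

section Intertwiners

variable {A H : Type*} [NonUnitalCStarAlgebra A]
  [NormedAddCommGroup H] [InnerProductSpace ℂ H] [CompleteSpace H]

namespace CStarRep

/-- The orbit map `a ↦ π a x`. -/
noncomputable def orbit (π : CStarRep A H) (x : H) : A →ₗ[ℂ] H where
  toFun a := π a x
  map_add' a b := by simp
  map_smul' c a := by simp

@[simp]
lemma orbit_apply (π : CStarRep A H) (x : H) (a : A) : orbit π x a = π a x := rfl

/-- The closed cyclic subspace generated by `x`. -/
noncomputable def cyclicSubspace (π : CStarRep A H) (x : H) : Submodule ℂ H :=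
  (orbit π x).range.topologicalClosure

lemma apply_mem_cyclicSubspace (π : CStarRep A H) (x : H) (a : A) :
    π a x ∈ cyclicSubspace π x :=
  subset_closure ⟨a, rfl⟩

instance (π : CStarRep A H) (x : H) : CompleteSpace (cyclicSubspace π x) :=
  (Submodule.isClosed_topologicalClosure _).completeSpace_coe

lemma mem_orthogonal_cyclicSubspace {π : CStarRep A H} {x y : H} :
    y ∈ (cyclicSubspace π x)ᗮ ↔ ∀ a, ⟪π a x, y⟫_ℂ = 0 := by
  rw [cyclicSubspace, Submodule.orthogonal_closure, Submodule.mem_orthogonal]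
  simp

/-- A vector of the cyclic subspace orthogonal to the orbit is zero. -/
lemma eq_zero_of_mem_cyclicSubspace {π : CStarRep A H} {x u : H} (hu : u ∈ cyclicSubspace π x)
    (h : ∀ a, ⟪π a x, u⟫_ℂ = 0) : u = 0 := by
  have := Submodule.inner_right_of_mem_orthogonal hu (mem_orthogonal_cyclicSubspace.2 h)
  simpa using this

lemma apply_mem_orthogonal_cyclicSubspace {π : CStarRep A H} {x y : H}
    (hy : y ∈ (cyclicSubspace π x)ᗮ) (a : A) : π a y ∈ (cyclicSubspace π x)ᗮ := by
  rw [mem_orthogonal_cyclicSubspace] at hy ⊢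
  intro b
  rw [inner_apply_right, ← mul_apply_eq_comp, ← map_mul, hy]

/-- If `‖ρ a y‖ ≤ ‖π a x‖`, then `π a x ↦ ρ a y` extends to an intertwiner which vanishes on
the orthogonal complement of the cyclic subspace of `x`. -/
lemma exists_intertwiner (π ρ : CStarRep A H) (x y : H) (h : ∀ a, ‖ρ a y‖ ≤ ‖π a x‖) :
    ∃ S : H →L[ℂ] H, Intertwines S π ρ ∧ (∀ a, S (π a x) = ρ a y) ∧
      ∀ u ∈ (cyclicSubspace π x)ᗮ, S u = 0 := by
  let M := cyclicSubspace π x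
  let e : A →ₗ[ℂ] M := (orbit π x).codRestrict M (apply_mem_cyclicSubspace π x)
  have he : DenseRange e := by
    rw [DenseRange, dense_iff_closure_eq, Set.eq_univ_iff_forall]
    rintro ⟨m, hm⟩
    rw [closure_subtype]
    have : Subtype.val '' Set.range e = ((orbit π x).range : Set H) := by
      rw [← Set.range_comp]; rfl
    rw [this]
    exact hm
  let S : H →L[ℂ] H := (orbit ρ y).extendOfNorm e ∘L M.orthogonalProjectionOnto
  have hS : ∀ a, S (π a x) = ρ a y := fun a => by
    have h1 : M.orthogonalProjectionOnto (π a x) = e a :=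
      M.orthogonalProjectionOnto_mem_subspace_eq_self (e a)
    simp only [S, ContinuousLinearMap.comp_apply, h1]
    exact LinearMap.extendOfNorm_eq he ⟨1, fun a => by rw [one_mul]; exact h a⟩ a
  have hS0 : ∀ u ∈ Mᗮ, S u = 0 := fun u hu => by
    simp [S, Submodule.orthogonalProjectionOnto_apply_of_mem_orthogonal hu]
  refine ⟨S, fun a => ?_, hS, hS0⟩
  ext v
  have hM : Set.EqOn (S * π a) (ρ a * S) M := by
    have : Set.EqOn (S * π a) (ρ a * S) (orbit π x).range := by
      rintro _ ⟨b, rfl⟩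
      have := hS (a * b)
      simp only [map_mul, mul_apply_eq_comp] at this
      simp [this, hS]
    exact this.closure (S * π a).continuous (ρ a * S).continuous
  obtain ⟨m, hm, n, hn, rfl⟩ := M.exists_add_mem_mem_orthogonal v
  rw [map_add, map_add, hM hm]
  simp [hS0 n hn, hS0 _ (apply_mem_orthogonal_cyclicSubspace hn a)]

/-- An operator vanishing on the complement of a cyclic subspace has its adjoint valued in it. -/
lemma star_apply_mem_cyclicSubspace {π : CStarRep A H} {x : H} {S : H →L[ℂ] H}
    (hS : ∀ u ∈ (cyclicSubspace π x)ᗮ, S u = 0) (v : H) : star S v ∈ cyclicSubspace π x := by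
  rw [← Submodule.orthogonal_orthogonal (cyclicSubspace π x), Submodule.mem_orthogonal]
  intro u hu
  rw [star_eq_adjoint, adjoint_inner_right, hS u hu, inner_zero_left]

end CStarRep

open CStarRep

/-- The vector functional of `(π, x)` is `φ`. -/
def CStarRep.Realizes (π : CStarRep A H) (x : H) (φ : A → ℂ) : Prop :=
  ∀ a, φ a = ⟪x, π a x⟫_ℂ

lemma CStarRep.Realizes.inner_apply_apply {π : CStarRep A H} {x : H} {φ : A → ℂ}
    (h : Realizes π x φ) (a b : A) : ⟪π a x, π b x⟫_ℂ = φ (star a * b) := by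
  rw [h, map_mul, inner_apply_left]; rfl

lemma CStarRep.Realizes.norm_sq {π : CStarRep A H} {x : H} {φ : A → ℂ}
    (h : Realizes π x φ) (a : A) : ((‖π a x‖ ^ 2 : ℝ) : ℂ) = φ (star a * a) := by
  rw [← h.inner_apply_apply, inner_self_eq_norm_sq_to_K]; simp

namespace IsContinuousField

variable {T : CStarRep A H → (H →L[ℂ] H)}

/-- The vector `x` may be changed by vectors annihilated by the representation. -/
lemma inner_congr (hT : IsContinuousField T) {π : CStarRep A H} {x x' y y' : H}
    (hx : ∀ a, π a x = π a x') (hy : ∀ a, π a y = π a y') :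
    ⟪x, T π y⟫_ℂ = ⟪x', T π y'⟫_ℂ := by
  have h1 : T π y = T π y' := by
    rw [← sub_eq_zero, ← map_sub]
    exact hT.apply_eq_zero fun a => by rw [map_sub, hy, sub_self]
  have h2 : star (T π) x = star (T π) x' := by
    rw [← sub_eq_zero, ← map_sub]
    exact hT.star.apply_eq_zero fun a => by rw [map_sub, hx, sub_self]
  rw [h1, ← adjoint_inner_left, ← adjoint_inner_left, ← star_eq_adjoint, h2]

/-- If `S` is the intertwiner with `S (π a x) = ρ a y`, then `(π, |S| x)` and `(ρ, y)` have the
same vector functional. -/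
lemma _root_.CStarRep.inner_adjoint_mul_self {π ρ : CStarRep A H} {x y : H} {S : H →L[ℂ] H}
    (hi : Intertwines S π ρ) (hS : ∀ a, S (π a x) = ρ a y) (a : A) :
    ⟪(star S * S) x, π a x⟫_ℂ = ⟪y, ρ a y⟫_ℂ := by
  have h : ∀ a v, ρ a (S v) = S (π a v) := fun a v => congr($(hi a) v).symm
  rw [mul_apply_eq_comp, star_eq_adjoint, adjoint_inner_left, hS, inner_apply_right,
    h, hS, inner_apply_left, star_star]

/-- The value `⟪x, T π x⟫` depends on the vector functional of `(π, x)` only. -/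
lemma inner_eq_of_realizes (hT : IsContinuousField T) {π ρ : CStarRep A H} {x y : H} {φ : A → ℂ}
    (hx : Realizes π x φ) (hy : Realizes ρ y φ) : ⟪x, T π x⟫_ℂ = ⟪y, T ρ y⟫_ℂ := by
  have hn : ∀ a, ‖ρ a y‖ = ‖π a x‖ := fun a => by
    have := hx.norm_sq a
    rw [← hy.norm_sq a] at this
    exact (sq_eq_sq₀ (norm_nonneg _) (norm_nonneg _)).1 (by exact_mod_cast this.symm)
  obtain ⟨S, hi, hS, hS0⟩ := exists_intertwiner π ρ x y fun a => (hn a).le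
  have hSS : ∀ m ∈ cyclicSubspace π x, (star S * S) m = m := fun m hm => by
    rw [← sub_eq_zero]
    refine eq_zero_of_mem_cyclicSubspace
      (sub_mem (star_apply_mem_cyclicSubspace hS0 _) hm) fun a => ?_
    rw [inner_sub_right, mul_apply_eq_comp, star_eq_adjoint, adjoint_inner_right, hS,
      sub_eq_zero]
    have : Set.EqOn (fun m => ⟪ρ a y, S m⟫_ℂ) (fun m => ⟪π a x, m⟫_ℂ) (orbit π x).range := by
      rintro _ ⟨b, rfl⟩
      simp [hS, hx.inner_apply_apply, hy.inner_apply_apply]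
    exact this.closure (by fun_prop) (by fun_prop) hm
  have hpi : IsPartialIsometry S := by
    rw [IsPartialIsometry]
    ext v
    obtain ⟨m, hm, n, hn, rfl⟩ := (cyclicSubspace π x).exists_add_mem_mem_orthogonal v
    have := hSS m hm
    simp only [mul_apply_eq_comp] at this
    simp [hS0 n hn, this]
  have hc := hT.compatible π ρ S hpi hi
  have h : ∀ a v, ρ a (S v) = S (π a v) := fun a v => congr($(hi a) v).symm
  -- In a degenerate representation `x` need not lie in its own cyclic subspace, so `S x` and `y`
  -- agree only up to a vector annihilated by `ρ`.
  have h1 : ⟪y, T ρ y⟫_ℂ = ⟪S x, T ρ (S x)⟫_ℂ :=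
    hT.inner_congr (fun a => by rw [h, hS]) (fun a => by rw [h, hS])
  have h2 : T ρ (S x) = S (T π x) := congr($hc x).symm
  rw [h1, h2, ← adjoint_inner_left S]
  refine hT.inner_congr (fun a => ?_) fun a => rfl
  have h3 := congr($(hi.adjoint a) (S x))
  simp only [mul_apply_eq_comp] at h3
  rw [← star_eq_adjoint, ← h3, h]
  exact (hSS _ (apply_mem_cyclicSubspace π x a)).symm

/-- The analogue of compatibility for an intertwiner `S` which need not be a partial isometry. -/
lemma inner_eq_of_intertwiner (hT : IsContinuousField T) {π ρ : CStarRep A H} {x y : H}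
    {S : H →L[ℂ] H} (hi : Intertwines S π ρ) (hS : ∀ a, S (π a x) = ρ a y) :
    ⟪y, T ρ y⟫_ℂ = ⟪(star S * S) x, T π x⟫_ℂ := by
  set h := star S * S with hh
  have h0 : 0 ≤ h := star_mul_self_nonneg S
  have hc : ∀ a, Commute h (π a) := fun a => by
    rw [commute_iff_eq, hh, mul_assoc, hi a, ← mul_assoc, hi.adjoint a, mul_assoc]
  set r := CFC.sqrt h
  have hr : IsSelfAdjoint r := (CFC.sqrt_nonneg h).isSelfAdjoint
  have hrr : r * r = h := CFC.sqrt_mul_sqrt_self h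
  have hrc : ∀ a, Commute r (π a) := fun a => (hc a).cfcₙ_nnreal _
  have hrT := hT.commute_selfAdjoint hr hrc
  have key : ∀ B : H →L[ℂ] H, Commute r B → ⟪r x, B (r x)⟫_ℂ = ⟪h x, B x⟫_ℂ := fun B hB => by
    have : B (r x) = r (B x) := congr($hB.eq x).symm
    rw [this, ← adjoint_inner_left, ← star_eq_adjoint, hr.star_eq, ← hrr,
      mul_apply_eq_comp]
  rw [← key _ hrT]
  -- With `r = √(S*S)` in the commutant of `π`, the pair `(π, r x)` has the functional of `(ρ, y)`,
  -- and `r` can be moved past `T π`.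
  refine (hT.inner_eq_of_realizes (φ := fun a => ⟪y, ρ a y⟫_ℂ) (fun a => ?_) fun a => rfl).symm
  rw [key _ (hrc a), hh, inner_adjoint_mul_self hi hS]

/-- `⟪x, T π x⟫` is additive in the vector functional of `(π, x)`. -/
lemma inner_add_of_realizes (hT : IsContinuousField T) {π ρ₁ ρ₂ : CStarRep A H} {x y₁ y₂ : H}
    {φ φ₁ φ₂ : A → ℂ} (h₁ : Realizes ρ₁ y₁ φ₁) (h₂ : Realizes ρ₂ y₂ φ₂) (hx : Realizes π x φ)
    (h : ∀ a, φ a = φ₁ a + φ₂ a) : ⟪x, T π x⟫_ℂ = ⟪y₁, T ρ₁ y₁⟫_ℂ + ⟪y₂, T ρ₂ y₂⟫_ℂ := by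
  have hn : ∀ a, ‖π a x‖ ^ 2 = ‖ρ₁ a y₁‖ ^ 2 + ‖ρ₂ a y₂‖ ^ 2 := fun a => by
    have := h (star a * a)
    rw [← hx.norm_sq, ← h₁.norm_sq, ← h₂.norm_sq] at this
    exact_mod_cast this
  obtain ⟨S₁, hi₁, hS₁, hS₁0⟩ := exists_intertwiner π ρ₁ x y₁ fun a =>
    abs_le_of_sq_le_sq' (by nlinarith [hn a, sq_nonneg ‖ρ₂ a y₂‖]) (norm_nonneg _) |>.2
  obtain ⟨S₂, hi₂, hS₂, hS₂0⟩ := exists_intertwiner π ρ₂ x y₂ fun a =>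
    abs_le_of_sq_le_sq' (by nlinarith [hn a, sq_nonneg ‖ρ₁ a y₁‖]) (norm_nonneg _) |>.2
  rw [hT.inner_eq_of_intertwiner hi₁ hS₁, hT.inner_eq_of_intertwiner hi₂ hS₂, ← inner_add_left]
  refine hT.inner_congr (fun a => ?_) fun a => rfl
  have hc₁ : π a ((star S₁ * S₁) x) = (star S₁ * S₁) (π a x) := by
    rw [← mul_apply_eq_comp, ← mul_apply_eq_comp, ← mul_assoc,
      ← hi₁.adjoint a, mul_assoc, ← hi₁ a, mul_assoc]
  have hc₂ : π a ((star S₂ * S₂) x) = (star S₂ * S₂) (π a x) := by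
    rw [← mul_apply_eq_comp, ← mul_apply_eq_comp, ← mul_assoc,
      ← hi₂.adjoint a, mul_assoc, ← hi₂ a, mul_assoc]
  -- It remains to see that `S₁*S₁ + S₂*S₂` fixes `π a x`; this is tested against the orbit of `x`,
  -- where it is the identity `φ = φ₁ + φ₂`.
  rw [map_add, hc₁, hc₂, eq_comm, ← sub_eq_zero]
  refine eq_zero_of_mem_cyclicSubspace (x := x) (π := π) (sub_mem (add_mem
    (star_apply_mem_cyclicSubspace hS₁0 _) (star_apply_mem_cyclicSubspace hS₂0 _))
    (apply_mem_cyclicSubspace π x a)) fun b => ?_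
  simp only [inner_sub_right, inner_add_right, mul_apply_eq_comp, star_eq_adjoint,
    adjoint_inner_right, hS₁, hS₂, h₁.inner_apply_apply, h₂.inner_apply_apply,
    hx.inner_apply_apply, h, sub_self]

end IsContinuousField
end Intertwiners

/-! ### Quasi-states and the GNS construction -/

section QuasiStates

variable {A : Type*} [NonUnitalCStarAlgebra A]

/-- A quasi-state: a positive functional of norm at most one. The second field combines positivity
with the Cauchy-Schwarz inequality. -/
structure IsQuasiState (φ : WeakDual ℂ A) : Prop where
  norm_le : ∀ a, ‖φ a‖ ≤ ‖a‖
  sq_le : ∀ a, ‖φ a‖ ^ 2 ≤ (φ (star a * a)).re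
  im_eq_zero : ∀ a, (φ (star a * a)).im = 0

namespace IsQuasiState

variable {φ : WeakDual ℂ A}

open scoped ComplexOrder in
/-- A quasi-state as a positive linear map. -/
noncomputable def toPositiveLinearMap [PartialOrder A] [StarOrderedRing A]
    (hφ : IsQuasiState φ) : A →ₚ[ℂ] ℂ :=
  PositiveLinearMap.mk₀ (φ : A →ₗ[ℂ] ℂ) fun a ha => by
    obtain ⟨b, rfl⟩ := CStarAlgebra.nonneg_iff_eq_star_mul_self.1 ha
    exact Complex.nonneg_iff.2 ⟨(sq_nonneg _).trans (hφ.sq_le b), (hφ.im_eq_zero b).symm⟩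

open scoped ComplexOrder in
lemma apply_star (hφ : IsQuasiState φ) (a : A) : φ (star a) = starRingEnd ℂ (φ a) := by
  let _ := CStarAlgebra.spectralOrder A
  let _ := CStarAlgebra.spectralOrderedRing A
  exact StarHomClass.map_star hφ.toPositiveLinearMap a

open scoped ComplexOrder in
/-- The GNS construction for quasi-states. -/
lemma exists_cyclic {A : Type u} [NonUnitalCStarAlgebra A] {φ : WeakDual ℂ A}
    (hφ : IsQuasiState φ) :
    ∃ (K : Type u) (_ : NormedAddCommGroup K) (_ : InnerProductSpace ℂ K) (_ : CompleteSpace K)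
      (σ : CStarRep A K) (ζ : K), σ.IsCyclicVector ζ ∧ ‖ζ‖ ≤ 1 ∧ σ.Realizes ζ φ := by
  let _ := CStarAlgebra.spectralOrder A
  let _ := CStarAlgebra.spectralOrderedRing A
  let f := hφ.toPositiveLinearMap
  have hf : ∀ a, f a = φ a := fun _ => rfl
  let e : A →ₗ[ℂ] f.GNS :=
    (UniformSpace.Completion.toComplL (𝕜 := ℂ) (E := f.PreGNS)).toLinearMap ∘ₗ f.toPreGNS.toLinearMap
  have he : ∀ a, e a = ((f.toPreGNS a : f.PreGNS) : f.GNS) := fun a => rfl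
  have hd : DenseRange e := by
    have : Function.Surjective f.toPreGNS := f.toPreGNS.surjective
    exact (UniformSpace.Completion.denseRange_coe (α := f.PreGNS)).comp this.denseRange
      (UniformSpace.Completion.continuous_coe _)
  have hinner : ∀ a b, ⟪e a, e b⟫_ℂ = φ (star a * b) := fun a b => by
    rw [he, he, UniformSpace.Completion.inner_coe, PositiveLinearMap.preGNS_inner_def, hf]
    simp
  -- Without a unit the cyclic vector comes from Riesz: `sq_le` says that `φ` is contractive for the
  -- GNS norm, so it extends to a functional represented by `ζ`.
  have hnorm : ∀ a, ‖φ a‖ ≤ 1 * ‖e a‖ := fun a => by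
    have h1 : ‖e a‖ ^ 2 = (φ (star a * a)).re := by
      rw [← hinner, ← inner_self_eq_norm_sq (𝕜 := ℂ)]; rfl
    rw [one_mul]
    exact abs_le_of_sq_le_sq' (h1 ▸ hφ.sq_le a) (norm_nonneg _) |>.2
  let l : StrongDual ℂ f.GNS := (φ : A →ₗ[ℂ] ℂ).extendOfNorm e
  have hl : ∀ a, l (e a) = φ a := fun a => LinearMap.extendOfNorm_eq hd ⟨1, hnorm⟩ a
  let ζ := (InnerProductSpace.toDual ℂ f.GNS).symm l
  have hζ : ∀ a, ⟪ζ, e a⟫_ℂ = φ a := fun a => by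
    rw [InnerProductSpace.toDual_symm_apply, hl]
  have hσe : ∀ a b, f.gnsNonUnitalStarAlgHom a (e b) = e (a * b) := fun a b => by
    rw [he, PositiveLinearMap.gnsNonUnitalStarAlgHom_apply_coe]
    rfl
  have hσ : ∀ a, f.gnsNonUnitalStarAlgHom a ζ = e a := fun a => by
    rw [← sub_eq_zero]
    refine hd.eq_zero_of_inner_right ℂ fun b => ?_
    rw [inner_sub_right, CStarRep.inner_apply_right, hσe, ← inner_conj_symm, hζ, hinner,
      ← hφ.apply_star]
    simp
  refine ⟨f.GNS, inferInstance, inferInstance, inferInstance, f.gnsNonUnitalStarAlgHom, ζ,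
    ?_, ?_, fun a => ?_⟩
  · rw [CStarRep.IsCyclicVector]
    simp only [hσ]
    exact hd
  · rw [LinearIsometryEquiv.norm_map]
    exact LinearMap.opNorm_extendOfNorm_le hd zero_le_one hnorm
  · rw [hσ, hζ]

/-- Every quasi-state is a vector functional of a representation on `H` which is cyclic up to a
degenerate summand. -/
lemma exists_realizes {A : Type u} [NonUnitalCStarAlgebra A]
    {H : Type v} [NormedAddCommGroup H] [InnerProductSpace ℂ H] [CompleteSpace H]
    (hH : StrictlyContainsCyclicReps A H) {φ : WeakDual ℂ A} (hφ : IsQuasiState φ) :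
    ∃ (π : CStarRep A H) (x : H), ‖x‖ ≤ 1 ∧ π.Realizes x φ ∧
      ∀ ξ, (∀ b, ⟪π b x, ξ⟫_ℂ = 0) → ∀ a, π a ξ = 0 := by
  obtain ⟨K, _, _, _, σ, ζ, hc, hn, hr⟩ := hφ.exists_cyclic
  obtain ⟨V, -⟩ := hH K σ ζ hc
  refine ⟨CStarRep.conjIsometry V σ, V ζ, by simpa using hn, fun a => ?_, fun ξ hξ a => ?_⟩
  · rw [CStarRep.inner_conjIsometry, CStarRep.adjoint_isometry_apply, hr]
  · have : adjoint V.toContinuousLinearMap ξ = 0 := by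
      refine hc.eq_zero_of_inner_right ℂ ?_
      rintro _ ⟨b, rfl⟩
      have := hξ b
      rw [CStarRep.conjIsometry_apply, CStarRep.adjoint_isometry_apply] at this
      rw [adjoint_inner_right]
      exact this
    simp [this]

end IsQuasiState

section VectorFunctional

variable {H : Type*} [NormedAddCommGroup H] [InnerProductSpace ℂ H] [CompleteSpace H]

/-- The vector functional `a ↦ ⟪x, π a x⟫`. -/
noncomputable def CStarRep.vectorFunctional (π : CStarRep A H) (x : H) : WeakDual ℂ A :=
  StrongDual.toWeakDual <| ((innerSL ℂ x).toLinearMap ∘ₗ π.orbit x).mkContinuous (‖x‖ ^ 2)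
    fun a => by
      have h1 := norm_inner_le_norm (𝕜 := ℂ) x (π a x)
      have h2 := (π a).le_opNorm x
      have h3 := NonUnitalStarAlgHom.norm_apply_le π a
      have h4 : ‖x‖ * (‖π a‖ * ‖x‖) ≤ ‖x‖ * (‖a‖ * ‖x‖) := by gcongr
      have h5 : ‖x‖ * ‖π a x‖ ≤ ‖x‖ * (‖π a‖ * ‖x‖) := by gcongr
      simp only [LinearMap.comp_apply, CStarRep.orbit_apply, coe_coe, innerSL_apply_apply]
      linarith

lemma CStarRep.realizes_vectorFunctional (π : CStarRep A H) (x : H) :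
    π.Realizes x (π.vectorFunctional x) := fun _ => rfl

lemma CStarRep.isQuasiState_vectorFunctional (π : CStarRep A H) {x : H} (hx : ‖x‖ ≤ 1) :
    IsQuasiState (π.vectorFunctional x) where
  norm_le a := by
    rw [π.realizes_vectorFunctional x]
    have h1 := norm_inner_le_norm (𝕜 := ℂ) x (π a x)
    have h2 := (π a).le_opNorm x
    have h3 := NonUnitalStarAlgHom.norm_apply_le π a
    have h4 : ‖π a‖ * ‖x‖ ≤ ‖a‖ * 1 := by gcongr
    have h5 : ‖x‖ * ‖π a x‖ ≤ 1 * (‖a‖ * 1) := by gcongr; exact h2.trans h4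
    linarith
  sq_le a := by
    rw [← (π.realizes_vectorFunctional x).norm_sq, Complex.ofReal_re,
      π.realizes_vectorFunctional x]
    have h1 := norm_inner_le_norm (𝕜 := ℂ) x (π a x)
    have h5 : ‖x‖ * ‖π a x‖ ≤ 1 * ‖π a x‖ := by gcongr
    rw [one_mul] at h5
    gcongr
    exact h1.trans h5
  im_eq_zero a := by
    rw [← (π.realizes_vectorFunctional x).norm_sq, Complex.ofReal_im]

end VectorFunctional

/-! ### Quasi-states attaining the norm of a selfadjoint element -/

section NormAttained

/-- A contractive functional with value one at the unit is positive. -/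
lemma CStarAlgebra.nonneg_of_contractive {B : Type*} [CStarAlgebra B] [PartialOrder B]
    [StarOrderedRing B] {g : StrongDual ℂ B} (hg : ∀ b, ‖g b‖ ≤ ‖b‖) (h1 : g 1 = 1) {c : B}
    (hc : 0 ≤ c) : 0 ≤ (g c).re ∧ (g c).im = 0 := by
  have : Nontrivial B := ⟨1, 0, fun h => by simp [h] at h1⟩
  have him : ∀ c : B, IsSelfAdjoint c → (g c).im = 0 := fun c hc => by
    have key : ∀ t : ℝ, ((g c).im + t) ^ 2 ≤ ‖c‖ ^ 2 + t ^ 2 := fun t => by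
      have h2 : star (c + (t * Complex.I) • (1 : B)) * (c + (t * Complex.I) • (1 : B)) =
          c * c + ((t : ℂ) ^ 2) • (1 : B) := by
        have hI : star (c + (t * Complex.I) • (1 : B)) = c - (t * Complex.I) • (1 : B) := by
          simp [hc.star_eq, sub_eq_add_neg]
        have hI2 : (t * Complex.I) * (t * Complex.I) = -(t ^ 2 : ℂ) := by
          ring_nf; simp
        rw [hI, sub_mul, mul_add, mul_add, smul_mul_smul_comm, hI2, mul_one, smul_mul_assoc,
          one_mul, mul_smul_comm, mul_one]
        module
      have h3 : ‖c + (t * Complex.I) • (1 : B)‖ ^ 2 ≤ ‖c‖ ^ 2 + t ^ 2 := by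
        rw [sq, ← CStarRing.norm_star_mul_self, h2]
        refine (norm_add_le _ _).trans ?_
        rw [hc.norm_mul_self, norm_smul]
        simp
      have h4 := hg (c + (t * Complex.I) • (1 : B))
      have h5 : (g c).im + t = (g (c + (t * Complex.I) • (1 : B))).im := by
        simp [h1]
      rw [h5]
      refine le_trans ?_ h3
      refine le_trans ?_ (pow_le_pow_left₀ (norm_nonneg _) h4 2)
      rw [← sq_abs]
      gcongr
      exact Complex.abs_im_le_norm _
    by_contra h0
    -- For this `t` the cross term `2 t Im (g c)` equals `‖c‖² + 1`, contradicting `key`.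
    have := key ((‖c‖ ^ 2 + 1) / (2 * (g c).im))
    have h6 : 2 * (g c).im * ((‖c‖ ^ 2 + 1) / (2 * (g c).im)) = ‖c‖ ^ 2 + 1 := by field_simp
    nlinarith [sq_nonneg (g c).im]
  refine ⟨?_, him c (IsSelfAdjoint.of_nonneg hc)⟩
  -- Applying `g` puts `g c` in the disc of radius `‖c‖` around `‖c‖`, which lies in the right
  -- half-plane.
  have h2 : ‖algebraMap ℝ B ‖c‖ - c‖ ≤ ‖c‖ := by
    refine (CStarAlgebra.norm_le_norm_of_nonneg_of_le (b := algebraMap ℝ B ‖c‖)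
      (sub_nonneg.2 (IsSelfAdjoint.le_algebraMap_norm_self (IsSelfAdjoint.of_nonneg hc)))
      (sub_le_self _ hc)).trans ?_
    rw [norm_algebraMap']; simp
  have h3 := (hg _).trans h2
  have h4 : g (algebraMap ℝ B ‖c‖) = ‖c‖ := by
    rw [Algebra.algebraMap_eq_smul_one, ← Complex.coe_smul, map_smul, h1]; simp
  rw [map_sub, h4] at h3
  have h5 := (Complex.abs_re_le_norm _).trans h3
  rw [Complex.sub_re, Complex.ofReal_re, abs_le] at h5
  linarith

open scoped ComplexOrder in
lemma CStarAlgebra.apply_star_of_contractive {B : Type*} [CStarAlgebra B] [PartialOrder B]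
    [StarOrderedRing B] {g : StrongDual ℂ B} (hg : ∀ b, ‖g b‖ ≤ ‖b‖) (h1 : g 1 = 1) (c : B) :
    g (star c) = starRingEnd ℂ (g c) := by
  let f : B →ₚ[ℂ] ℂ := PositiveLinearMap.mk₀ g.toLinearMap fun a ha => by
    obtain ⟨h2, h3⟩ := nonneg_of_contractive hg h1 ha
    exact Complex.nonneg_iff.2 ⟨h2, h3.symm⟩
  exact map_star f c

/-- The norm of a selfadjoint element of a unital C⋆-algebra is attained at a contractive functional
with value one at the unit. -/
lemma CStarAlgebra.exists_contractive_norm_apply {B : Type*} [CStarAlgebra B] [Nontrivial B]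
    {b : B} (hb : IsSelfAdjoint b) :
    ∃ g : StrongDual ℂ B, (∀ c, ‖g c‖ ≤ ‖c‖) ∧ g 1 = 1 ∧ ‖g b‖ = ‖b‖ := by
  have : IsStarNormal b := hb.isStarNormal
  -- A spectral value of modulus `‖b‖` is a character of the C⋆-algebra generated by `b`;
  -- Hahn-Banach extends it to `B`.
  obtain ⟨z, hz, hzn⟩ := spectrum.exists_nnnorm_eq_spectralRadius b
  rw [hb.spectralRadius_eq_nnnorm] at hzn
  obtain ⟨χ, hχ⟩ := (StarAlgebra.elemental.bijective_characterSpaceToSpectrum b).2 ⟨z, hz⟩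
  have hχb : χ ⟨b, StarAlgebra.elemental.self_mem ℂ b⟩ = z := congrArg Subtype.val hχ
  let p : Submodule ℂ B := (StarAlgebra.elemental ℂ b).toSubalgebra.toSubmodule
  let l : StrongDual ℂ p := LinearMap.mkContinuous
    (WeakDual.CharacterSpace.toAlgHom χ).toLinearMap 1 fun x => by
      rw [one_mul]
      exact AlgHom.norm_apply_le_self (A := StarAlgebra.elemental ℂ b) χ x
  obtain ⟨g, hg, hgn⟩ := exists_extension_norm_eq p l
  refine ⟨g, fun c => ?_, ?_, ?_⟩
  · have h1 : ‖g‖ ≤ 1 := hgn.le.trans (LinearMap.mkContinuous_norm_le _ zero_le_one _)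
    simpa using g.le_of_opNorm_le h1 c
  · exact (hg ⟨1, one_mem (StarAlgebra.elemental ℂ b)⟩).trans (map_one χ)
  · rw [hg ⟨b, StarAlgebra.elemental.self_mem ℂ b⟩]
    change ‖χ ⟨b, _⟩‖ = _
    rw [hχb]
    exact congrArg NNReal.toReal (ENNReal.coe_injective hzn)

/-- The norm of a selfadjoint element is attained at a quasi-state. -/
lemma exists_isQuasiState_norm_apply {a : A} (ha : IsSelfAdjoint a) :
    ∃ φ : WeakDual ℂ A, IsQuasiState φ ∧ ‖φ a‖ = ‖a‖ := by
  let _ := CStarAlgebra.spectralOrder (Unitization ℂ A)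
  let _ := CStarAlgebra.spectralOrderedRing (Unitization ℂ A)
  let i := Unitization.inrNonUnitalStarAlgHom ℂ A
  have hin : ∀ a, ‖i a‖ = ‖a‖ := fun a => Unitization.norm_inr a
  obtain ⟨g, hg, hg1, hgb⟩ := CStarAlgebra.exists_contractive_norm_apply (ha.map i)
  let φ : WeakDual ℂ A := StrongDual.toWeakDual <|
    (g.toLinearMap ∘ₗ (i : A →ₗ[ℂ] Unitization ℂ A)).mkContinuous 1 fun a => by
      rw [one_mul, ← hin]; exact hg _
  have hφ : ∀ a, φ a = g (i a) := fun _ => rfl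
  refine ⟨φ, ⟨fun a => by rw [hφ, ← hin]; exact hg _, fun a => ?_, fun a => ?_⟩, ?_⟩
  · set c := i a
    have hm : φ (star a * a) = g (star c * c) := by rw [hφ, map_mul, map_star]
    have hs := CStarAlgebra.apply_star_of_contractive hg hg1 c
    -- Positivity at `(c - g c)* (c - g c)` is the Cauchy-Schwarz inequality `‖g c‖² ≤ g (c* c)`.
    have h1 := (CStarAlgebra.nonneg_of_contractive hg hg1
      (star_mul_self_nonneg (c - (g c) • 1))).1
    have h2 : g (star (c - (g c) • 1) * (c - (g c) • 1)) = g (star c * c) - ‖g c‖ ^ 2 := by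
      have : star (c - (g c) • (1 : Unitization ℂ A)) * (c - (g c) • 1) =
          star c * c - (g c) • star c - (starRingEnd ℂ (g c)) • c +
            (starRingEnd ℂ (g c) * g c) • (1 : Unitization ℂ A) := by
        rw [star_sub, star_smul, star_one, sub_mul, mul_sub, mul_sub, smul_mul_smul_comm,
          smul_mul_assoc, mul_smul_comm, one_mul, mul_one, mul_one]
        simp only [RCLike.star_def]
        module
      rw [this, map_add, map_sub, map_sub, map_smul, map_smul, map_smul, hs, hg1]
      simp only [smul_eq_mul, mul_one, Complex.conj_mul']
      rw [Complex.mul_conj']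
      ring
    rw [h2] at h1
    rw [hφ, hm]
    rw [Complex.sub_re, ← Complex.ofReal_pow, Complex.ofReal_re] at h1
    linarith
  · rw [hφ, map_mul, map_star]
    exact (CStarAlgebra.nonneg_of_contractive hg hg1 (star_mul_self_nonneg (i a))).2
  · rw [hφ, hgb, hin]

end NormAttained

end QuasiStates

/-! ### Kadison's function representation on the quasi-state space -/

section AffineFunctions

variable {A : Type*} [NonUnitalCStarAlgebra A]

lemma isQuasiState_zero : IsQuasiState (0 : WeakDual ℂ A) where
  norm_le a := norm_zero.le.trans (norm_nonneg a)
  sq_le a := by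
    change ‖(0 : ℂ)‖ ^ 2 ≤ (0 : ℂ).re
    simp
  im_eq_zero _ := rfl

/-- For each fixed `a` the defining conditions are closed in the weak* topology, and they confine
`φ` to the unit ball, so Banach-Alaoglu applies. -/
lemma isCompact_setOf_isQuasiState : IsCompact {φ : WeakDual ℂ A | IsQuasiState φ} := by
  refine (WeakDual.isCompact_closedBall (𝕜 := ℂ) (E := A) 0 1).of_isClosed_subset ?_ fun φ hφ => ?_
  · have he : ∀ a : A, Continuous fun φ : WeakDual ℂ A => φ a := WeakDual.eval_continuous
    have : {φ : WeakDual ℂ A | IsQuasiState φ} = {φ | ∀ a, ‖φ a‖ ≤ ‖a‖} ∩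
        ({φ | ∀ a, ‖φ a‖ ^ 2 ≤ (φ (star a * a)).re} ∩ {φ | ∀ a, (φ (star a * a)).im = 0}) := by
      ext φ
      exact ⟨fun h => ⟨h.1, h.2, h.3⟩, fun h => ⟨h.1, h.2.1, h.2.2⟩⟩
    rw [this]
    simp only [Set.ofPred_forall]
    exact (isClosed_iInter fun a => isClosed_le (he a).norm continuous_const).inter
      ((isClosed_iInter fun a => isClosed_le ((he a).norm.pow 2)
        (Complex.continuous_re.comp (he _))).inter
      (isClosed_iInter fun a => isClosed_eq (Complex.continuous_im.comp (he _)) continuous_const))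
  · rw [Set.mem_preimage, mem_closedBall_zero_iff]
    exact ContinuousLinearMap.opNorm_le_bound _ zero_le_one fun a => by
      rw [one_mul]; exact hφ.norm_le a

lemma convex_setOf_isQuasiState : Convex ℝ {φ : WeakDual ℂ A | IsQuasiState φ} := by
  intro φ hφ ψ hψ s t hs ht hst
  have happ : ∀ a, (s • φ + t • ψ) a = s * φ a + t * ψ a := fun a => by
    change s • φ a + t • ψ a = _
    simp
  have hle : ∀ a, ‖(s • φ + t • ψ) a‖ ≤ s * ‖φ a‖ + t * ‖ψ a‖ := fun a => by
    rw [happ]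
    refine (norm_add_le _ _).trans ?_
    simp [abs_of_nonneg hs, abs_of_nonneg ht]
  refine ⟨fun a => (hle a).trans ?_, fun a => ?_, fun a => ?_⟩
  · calc s * ‖φ a‖ + t * ‖ψ a‖ ≤ s * ‖a‖ + t * ‖a‖ := by
          gcongr
          exacts [hφ.norm_le a, hψ.norm_le a]
      _ = ‖a‖ := by rw [← add_mul, hst, one_mul]
  · calc ‖(s • φ + t • ψ) a‖ ^ 2 ≤ (s * ‖φ a‖ + t * ‖ψ a‖) ^ 2 := by gcongr; exact hle a
      _ ≤ s * ‖φ a‖ ^ 2 + t * ‖ψ a‖ ^ 2 := by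
          obtain rfl : t = 1 - s := by linarith
          nlinarith [mul_nonneg (mul_nonneg hs ht) (sq_nonneg (‖φ a‖ - ‖ψ a‖))]
      _ ≤ s * (φ (star a * a)).re + t * (ψ (star a * a)).re := by
          gcongr
          exacts [hφ.sq_le a, hψ.sq_le a]
      _ = _ := by rw [happ]; simp
  · rw [happ]; simp [hφ.im_eq_zero, hψ.im_eq_zero]

/-- Hahn-Banach in a locally convex product; it serves to separate the graph of an affine function
from a vertical translate of it. -/
lemma separate_weakDual_prod {s t : Set (WeakDual ℂ A × ℂ)} (hs : Convex ℝ s) (hs' : IsCompact s)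
    (ht : Convex ℝ t) (ht' : IsClosed t) (hd : Disjoint s t) :
    ∃ (L : StrongDual ℂ (WeakDual ℂ A × ℂ)) (u v : ℝ),
      (∀ p ∈ s, (L p).re < u) ∧ u < v ∧ ∀ p ∈ t, v < (L p).re := by
  have : LocallyConvexSpace ℝ (WeakDual ℂ A) :=
    inferInstanceAs (LocallyConvexSpace ℝ (WeakBilin (topDualPairing ℂ A)))
  have hl : LocallyConvexSpace ℝ (WeakDual ℂ A × ℂ) := Prod.locallyConvexSpace
  have : IsScalarTower ℝ ℂ (WeakDual ℂ A) :=
    ⟨fun r c φ => ContinuousLinearMap.ext fun a => smul_assoc r c (φ a)⟩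
  exact @RCLike.geometric_hahn_banach_compact_closed ℂ (WeakDual ℂ A × ℂ) _ _ _ s t _ _ _ _ _ hl
    hs hs' ht ht' hd

variable {f : WeakDual ℂ A → ℝ}

/-- A continuous affine function on the quasi-states vanishing at zero is uniformly approximated
by evaluations at selfadjoint elements. -/
lemma exists_selfAdjoint_approx (hf : ContinuousOn f {φ | IsQuasiState φ})
    (haff : ∀ φ ψ, IsQuasiState φ → IsQuasiState ψ → ∀ s t : ℝ, 0 ≤ s → 0 ≤ t → s + t = 1 →
      f (s • φ + t • ψ) = s * f φ + t * f ψ) (h0 : f 0 = 0) {ε : ℝ} (hε : 0 < ε) :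
    ∃ a : A, IsSelfAdjoint a ∧ ∀ φ, IsQuasiState φ → ‖φ a - f φ‖ ≤ ε := by
  let Q := {φ : WeakDual ℂ A | IsQuasiState φ}
  -- `G c` is the graph of `f` raised by `c`. A hyperplane between `G 0` and `G ε` is the graph of
  -- an affine function within `ε` of `f`.
  let G : ℝ → Set (WeakDual ℂ A × ℂ) := fun c => (fun φ => (φ, ((f φ + c : ℝ) : ℂ))) '' Q
  have hcomp : ∀ c, IsCompact (G c) := fun c =>
    isCompact_setOf_isQuasiState.image_of_continuousOn
      (continuousOn_id.prodMk (Complex.continuous_ofReal.comp_continuousOn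
        (hf.add continuousOn_const)))
  have hconv : ∀ c, Convex ℝ (G c) := by
    rintro c _ ⟨φ, hφ, rfl⟩ _ ⟨ψ, hψ, rfl⟩ s t hs ht hst
    refine ⟨s • φ + t • ψ, convex_setOf_isQuasiState hφ hψ hs ht hst, ?_⟩
    refine Prod.ext rfl ?_
    simp only [haff φ ψ hφ hψ s t hs ht hst, Prod.snd_add, Prod.smul_snd, Complex.real_smul]
    push_cast
    have : (s : ℂ) + t = 1 := by exact_mod_cast hst
    linear_combination (-(c : ℂ)) * this
  have hdisj : Disjoint (G 0) (G ε) := by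
    rw [Set.disjoint_left]
    rintro _ ⟨φ, hφ, rfl⟩ ⟨ψ, hψ, h⟩
    simp only [Prod.mk.injEq] at h
    obtain ⟨rfl, h⟩ := h
    have := Complex.ofReal_injective h
    linarith
  obtain ⟨L, u, v, h1, huv, h2⟩ := separate_weakDual_prod (hconv 0) (hcomp 0) (hconv ε)
    (hcomp ε).isClosed hdisj
  -- Weak* continuous functionals are evaluations, so the slope of the hyperplane is given by an
  -- element `b` of `A`.
  obtain ⟨b, hb⟩ := LinearMap.dualEmbedding_surjective (topDualPairing ℂ A)
    (L ∘L ContinuousLinearMap.inl ℂ (WeakDual ℂ A) ℂ)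
  have hb' : ∀ φ : WeakDual ℂ A, L (φ, 0) = φ b := fun φ => congr($hb φ).symm
  let k := (L (0, 1)).re
  have hL : ∀ (φ : WeakDual ℂ A) (r : ℝ), (L (φ, (r : ℂ))).re = (φ b).re + r * k := fun φ r => by
    have : (φ, (r : ℂ)) = (φ, 0) + (r : ℂ) • (0, 1) := by simp
    rw [this, map_add, map_smul, hb']
    simp [k]
  have key : ∀ φ ψ : WeakDual ℂ A, IsQuasiState φ → IsQuasiState ψ →
      (φ b).re + f φ * k < (ψ b).re + (f ψ + ε) * k := fun φ ψ hφ hψ => by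
    have h3 := h1 _ ⟨φ, hφ, rfl⟩
    have h4 := h2 _ ⟨ψ, hψ, rfl⟩
    simp only [add_zero, hL] at h3 h4
    linarith
  have hk : 0 < k := by
    have := key 0 0 isQuasiState_zero isQuasiState_zero
    have h5 : 0 < ε * k := by linarith
    exact pos_of_mul_pos_right h5 hε.le
  let a : A := (-(2 * k)⁻¹ : ℝ) • (b + star b)
  have ha : IsSelfAdjoint a := IsSelfAdjoint.smul (star_trivial _) (IsSelfAdjoint.add_star_self b)
  refine ⟨a, ha, fun φ hφ => ?_⟩
  have h3 : φ a = ((-(φ b).re / k : ℝ) : ℂ) := by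
    simp only [a]
    rw [← Complex.coe_smul, map_smul, map_add, hφ.apply_star, Complex.add_conj]
    simp
    field_simp
  rw [h3, ← Complex.ofReal_sub, Complex.norm_real, Real.norm_eq_abs]
  have h4 := key φ 0 hφ isQuasiState_zero
  have h5 := key 0 φ isQuasiState_zero hφ
  have h00 : (0 : WeakDual ℂ A) b = 0 := rfl
  simp only [h0, h00, Complex.zero_re, zero_mul, zero_add] at h4 h5
  have h6 : -(φ b).re / k - f φ = -((φ b).re + f φ * k) / k := by field_simp; ring
  rw [h6, abs_div, abs_of_pos hk, div_le_iff₀ hk, abs_le]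
  constructor <;> linarith

/-- Kadison's function representation: a continuous affine real function on the quasi-states
vanishing at zero is the evaluation at an element of the algebra. -/
lemma exists_apply_eq_of_affine (hf : ContinuousOn f {φ | IsQuasiState φ})
    (haff : ∀ φ ψ, IsQuasiState φ → IsQuasiState ψ → ∀ s t : ℝ, 0 ≤ s → 0 ≤ t → s + t = 1 →
      f (s • φ + t • ψ) = s * f φ + t * f ψ) (h0 : f 0 = 0) :
    ∃ a : A, ∀ φ, IsQuasiState φ → φ a = f φ := by
  have hpos : ∀ n : ℕ, (0 : ℝ) < 1 / ((n : ℝ) + 1) := fun n => Nat.one_div_pos_of_nat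
  choose a ha hfa using fun n : ℕ => exists_selfAdjoint_approx hf haff h0 (hpos n)
  -- Quasi-states norm the selfadjoint elements, so uniform approximation of `f` makes `a` a Cauchy
  -- sequence.
  have hd : ∀ m n, ‖a m - a n‖ ≤ 1 / ((m : ℝ) + 1) + 1 / ((n : ℝ) + 1) := fun m n => by
    obtain ⟨φ, hφ, h⟩ := exists_isQuasiState_norm_apply ((ha m).sub (ha n))
    rw [← h, map_sub, show φ (a m) - φ (a n) = (φ (a m) - f φ) - (φ (a n) - f φ) by ring]
    exact (norm_sub_le _ _).trans (add_le_add (hfa m φ hφ) (hfa n φ hφ))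
  have hc : CauchySeq a := by
    refine cauchySeq_of_le_tendsto_0 (fun n : ℕ => 2 * (1 / ((n : ℝ) + 1))) (fun m n N hm hn => ?_) ?_
    · rw [dist_eq_norm, two_mul]
      exact (hd m n).trans (add_le_add (Nat.one_div_le_one_div hm) (Nat.one_div_le_one_div hn))
    · simpa using tendsto_one_div_add_atTop_nhds_zero_nat.const_mul (2 : ℝ)
  obtain ⟨b, hb⟩ := cauchySeq_tendsto_of_complete hc
  refine ⟨b, fun φ hφ => ?_⟩
  have h1 : Filter.Tendsto (fun n => φ (a n)) Filter.atTop (nhds (φ b)) :=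
    (φ.continuous.tendsto b).comp hb
  refine tendsto_nhds_unique h1 (tendsto_iff_norm_sub_tendsto_zero.2 ?_)
  exact squeeze_zero (fun _ => norm_nonneg _) (fun n => hfa n φ hφ)
    tendsto_one_div_add_atTop_nhds_zero_nat

end AffineFunctions

open Filter Topology

/-! ### The affine function of a field -/

section FieldFunctional

variable {A H : Type*} [NonUnitalCStarAlgebra A]
  [NormedAddCommGroup H] [InnerProductSpace ℂ H] [CompleteSpace H]

open CStarRep

open Classical in
/-- The function on functionals induced by `T`: its value at a vector functional `a ↦ ⟪x, π a x⟫`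
is `⟪x, T π x⟫`. -/
noncomputable def fieldFunctional (T : CStarRep A H → (H →L[ℂ] H)) (φ : WeakDual ℂ A) : ℂ :=
  if h : ∃ p : CStarRep A H × H, p.1.Realizes p.2 φ then ⟪h.choose.2, T h.choose.1 h.choose.2⟫_ℂ
  else 0

namespace IsContinuousField

variable {T : CStarRep A H → (H →L[ℂ] H)}

lemma fieldFunctional_eq (hT : IsContinuousField T) {π : CStarRep A H} {x : H} {φ : WeakDual ℂ A}
    (h : π.Realizes x φ) : fieldFunctional T φ = ⟪x, T π x⟫_ℂ := by
  have h' : ∃ p : CStarRep A H × H, p.1.Realizes p.2 φ := ⟨(π, x), h⟩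
  rw [fieldFunctional, dif_pos h']
  exact hT.inner_eq_of_realizes h'.choose_spec h

lemma fieldFunctional_zero (hT : IsContinuousField T) :
    fieldFunctional T (0 : WeakDual ℂ A) = 0 := by
  rw [hT.fieldFunctional_eq (π := 0) (x := 0) fun a => by rw [inner_zero_left]; rfl]
  simp

end IsContinuousField

lemma CStarRep.Realizes.smul {π : CStarRep A H} {x : H} {φ : WeakDual ℂ A}
    (h : π.Realizes x φ) {s : ℝ} (hs : 0 ≤ s) : π.Realizes ((√s : ℂ) • x) (s • φ) := fun a => by
  rw [map_smul, inner_smul_left, inner_smul_right, ← h, Complex.conj_ofReal, ← mul_assoc,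
    ← Complex.ofReal_mul, Real.mul_self_sqrt hs]
  exact Complex.real_smul

end FieldFunctional

section Affine

variable {A : Type u} [NonUnitalCStarAlgebra A]
  {H : Type v} [NormedAddCommGroup H] [InnerProductSpace ℂ H] [CompleteSpace H]
  {T : CStarRep A H → (H →L[ℂ] H)}

open CStarRep

/-- Scaling a realizing vector by `√s` scales its functional by `s`; the rest is additivity in the
functional. -/
lemma IsContinuousField.fieldFunctional_affine (hT : IsContinuousField T)
    (hH : StrictlyContainsCyclicReps A H) {φ ψ : WeakDual ℂ A} (hφ : IsQuasiState φ)
    (hψ : IsQuasiState ψ) {s t : ℝ} (hs : 0 ≤ s) (ht : 0 ≤ t) (hst : s + t = 1) :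
    fieldFunctional T (s • φ + t • ψ) = s * fieldFunctional T φ + t * fieldFunctional T ψ := by
  obtain ⟨π₁, x₁, -, h₁, -⟩ := hφ.exists_realizes hH
  obtain ⟨π₂, x₂, -, h₂, -⟩ := hψ.exists_realizes hH
  obtain ⟨π, x, -, h, -⟩ := (convex_setOf_isQuasiState hφ hψ hs ht hst).exists_realizes hH
  have hsm : ∀ (r : ℝ) (π : CStarRep A H) (x : H), 0 ≤ r →
      ⟪(√r : ℂ) • x, T π ((√r : ℂ) • x)⟫_ℂ = r * ⟪x, T π x⟫_ℂ := fun r π x hr => by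
    rw [map_smul, inner_smul_left, inner_smul_right, Complex.conj_ofReal, ← mul_assoc,
      ← Complex.ofReal_mul, Real.mul_self_sqrt hr]
  rw [hT.fieldFunctional_eq h, hT.fieldFunctional_eq h₁, hT.fieldFunctional_eq h₂,
    hT.inner_add_of_realizes (h₁.smul hs) (h₂.smul ht) h fun a => rfl, hsm _ _ _ hs, hsm _ _ _ ht]

end Affine

/-! ### Continuity in finite dimension, by compactness -/

section FiniteDimensional

/-- In finite dimension, weak convergence of operators and norm convergence of vectors imply
convergence of the quadratic forms. -/
lemma tendsto_inner_of_weak {H : Type*} [NormedAddCommGroup H]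
    [InnerProductSpace ℂ H] [FiniteDimensional ℂ H] {ι : Type*} {l : Filter ι}
    {B : ι → H →L[ℂ] H} {B₀ : H →L[ℂ] H} {x : ι → H} {x₀ : H}
    (hB : ∀ u v, Tendsto (fun i => ⟪v, B i u⟫_ℂ) l (𝓝 ⟪v, B₀ u⟫_ℂ)) (hx : Tendsto x l (𝓝 x₀)) :
    Tendsto (fun i => ⟪x i, B i (x i)⟫_ℂ) l (𝓝 ⟪x₀, B₀ x₀⟫_ℂ) := by
  let e := stdOrthonormalBasis ℂ H
  have key : ∀ (C : H →L[ℂ] H) (y : H),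
      ⟪y, C y⟫_ℂ = ∑ j, ∑ k, ⟪e k, y⟫_ℂ * (⟪y, e j⟫_ℂ * ⟪e j, C (e k)⟫_ℂ) := fun C y => by
    rw [← e.sum_inner_mul_inner y (C y)]
    refine Finset.sum_congr rfl fun j _ => ?_
    conv_lhs => rw [← e.sum_repr' y, map_sum, inner_sum, Finset.mul_sum]
    refine Finset.sum_congr rfl fun k _ => ?_
    rw [map_smul, inner_smul_right, e.sum_repr' y]
    ring
  simp only [key]
  exact tendsto_finsetSum _ fun j _ => tendsto_finsetSum _ fun k _ =>
    (tendsto_const_nhds.inner hx).mul ((hx.inner tendsto_const_nhds).mul (hB _ _))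

variable {A : Type u} [NonUnitalCStarAlgebra A]
  {H : Type v} [NormedAddCommGroup H] [InnerProductSpace ℂ H] [CompleteSpace H]

open CStarRep

/-- A pointwise norm limit of representations is a representation. -/
noncomputable def CStarRep.ofTendsto {ι : Type*} {l : Filter ι} [l.NeBot] {π : ι → CStarRep A H}
    {p : A → (H →L[ℂ] H)} (h : ∀ a, Tendsto (fun i => π i a) l (𝓝 (p a))) : CStarRep A H where
  toFun := p
  map_smul' c a := tendsto_nhds_unique (h (c • a)) (by simpa using (h a).const_smul c)
  map_zero' := tendsto_nhds_unique (h 0) (by simp)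
  map_add' a b := tendsto_nhds_unique (h (a + b)) (by simpa using (h a).add (h b))
  map_mul' a b := tendsto_nhds_unique (h (a * b)) (by simpa using (h a).mul (h b))
  map_star' a := tendsto_nhds_unique (h (star a)) (by simpa [map_star] using (h a).star)

/-- If `H` is finite-dimensional, the representations on `H` form a compact space. -/
lemma CStarRep.exists_ultrafilter_limit [FiniteDimensional ℂ H] {ι : Type*} (g : Ultrafilter ι)
    (π : ι → CStarRep A H) : ∃ π₀ : CStarRep A H, ∀ a, Tendsto (fun i => π i a) g (𝓝 (π₀ a)) := by
  have : ∀ a : A, ∃ p : H →L[ℂ] H, Tendsto (fun i => π i a) g (𝓝 p) := fun a => by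
    have : ProperSpace (H →L[ℂ] H) := FiniteDimensional.proper ℂ _
    obtain ⟨p, -, hp⟩ := (isCompact_closedBall (0 : H →L[ℂ] H) ‖a‖).ultrafilter_le_nhds
      (g.map fun i => π i a) (by
        rw [le_principal_iff]
        exact (univ_mem' fun i => by
          rw [Set.mem_preimage, mem_closedBall_zero_iff]
          exact NonUnitalStarAlgHom.norm_apply_le (π i) a :
            (fun i => π i a) ⁻¹' Metric.closedBall 0 ‖a‖ ∈ (g : Filter ι)))
    exact ⟨p, hp⟩
  choose p hp using this
  exact ⟨CStarRep.ofTendsto hp, hp⟩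

/-- Along an ultrafilter the realizing representations and vectors both converge in norm, and the
limit pair realizes the limit functional. -/
lemma IsContinuousField.continuousOn_of_finiteDimensional [FiniteDimensional ℂ H]
    {T : CStarRep A H → (H →L[ℂ] H)} (hT : IsContinuousField T)
    (hH : StrictlyContainsCyclicReps A H) :
    ContinuousOn (fieldFunctional T) {φ : WeakDual ℂ A | IsQuasiState φ} := by
  rw [continuousOn_iff_continuous_domRestrict, continuous_iff_ultrafilter]
  intro φ₀ g hg
  choose π x hx hr _ using fun φ : {φ : WeakDual ℂ A | IsQuasiState φ} =>
    (show IsQuasiState φ.1 from φ.2).exists_realizes hH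
  obtain ⟨π₀, hπ₀⟩ := exists_ultrafilter_limit g π
  have : ProperSpace H := FiniteDimensional.proper ℂ _
  obtain ⟨x₀, -, hx₀⟩ := (isCompact_closedBall (0 : H) 1).ultrafilter_le_nhds (g.map x) (by
    rw [le_principal_iff]
    exact (univ_mem' fun i => by simpa using hx i :
      x ⁻¹' Metric.closedBall 0 1 ∈ (g : Filter _)))
  replace hx₀ : Tendsto x g (𝓝 x₀) := hx₀
  have hπw : ∀ a u v, Tendsto (fun i => ⟪v, π i a u⟫_ℂ) g (𝓝 ⟪v, π₀ a u⟫_ℂ) := fun a u v =>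
    tendsto_const_nhds.inner 
      (((ContinuousLinearMap.apply ℂ H u).continuous.tendsto _).comp (hπ₀ a))
  have hr₀ : π₀.Realizes x₀ φ₀.1 := fun a => by
    have h1 : Tendsto (fun φ : {φ : WeakDual ℂ A | IsQuasiState φ} => φ.1 a) g (𝓝 (φ₀.1 a)) :=
      ((WeakDual.eval_continuous a).comp continuous_subtype_val).continuousAt.tendsto.mono_left hg
    refine tendsto_nhds_unique h1 ?_
    simp only [fun φ => hr φ a]
    exact tendsto_inner_of_weak (hπw a) hx₀
  have hlim : Tendsto π g (𝓝 π₀) := by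
    rw [isInducing_coeff.nhds_eq_comap, tendsto_comap_iff]
    exact tendsto_pi_nhds.2 fun t => hπw _ _ _
  have h2 : ∀ u v, Tendsto (fun i => ⟪v, T (π i) u⟫_ℂ) g (𝓝 ⟪v, T π₀ u⟫_ℂ) := fun u v =>
    ((hT.continuous_inner u v).tendsto π₀).comp hlim
  have h3 := tendsto_inner_of_weak h2 hx₀
  rw [← hT.fieldFunctional_eq hr₀] at h3
  exact h3.congr fun φ => (hT.fieldFunctional_eq (hr φ)).symm

end FiniteDimensional

/-! ### Isometric dilations and Gram matrix estimates -/

section HilbertSpace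

variable {H : Type*} [NormedAddCommGroup H] [InnerProductSpace ℂ H] [CompleteSpace H]

/-- An infinite-dimensional Hilbert space embeds isometrically into the orthogonal complement of
any finite-dimensional subspace. -/
lemma exists_isometry_orthogonal (hinf : ¬ FiniteDimensional ℂ H) (M : Submodule ℂ H)
    [FiniteDimensional ℂ M] : ∃ R : H →ₗᵢ[ℂ] H, ∀ m ∈ M, ∀ u, ⟪m, R u⟫_ℂ = 0 := by
  let e := stdOrthonormalBasis ℂ M
  let s : Set H := Set.range fun i => (e i : H)
  have hso : Orthonormal ℂ (fun i => (e i : H)) :=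
    e.orthonormal.comp_linearIsometry M.subtypeₗᵢ
  obtain ⟨w, b, hsw, hb⟩ := hso.toSubtypeRange.exists_hilbertBasis_extension
  have hw : Infinite w := by
    by_contra h
    rw [not_infinite_iff_finite] at h
    have := Fintype.ofFinite w
    exact hinf b.toOrthonormalBasis.toBasis.finiteDimensional_of_finite
  let t : Set w := {i | (i : H) ∈ s}
  have ht : t.Finite := (Set.finite_range _).preimage Subtype.val_injective.injOn
  -- Removing the finitely many basis vectors in `M` keeps the cardinality of the basis; reindexing
  -- the basis gives `R`.
  have hcard : Cardinal.mk ↑tᶜ = Cardinal.mk w := by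
    refine Cardinal.mk_compl_of_infinite t ?_
    have := ht.to_subtype
    exact (Cardinal.mk_lt_aleph0_iff.2 this).trans_le (Cardinal.aleph0_le_mk w)
  obtain ⟨f⟩ := Cardinal.eq.1 hcard.symm
  have hv : Orthonormal ℂ fun i : w => b (f i) :=
    b.orthonormal.comp (fun i => (f i : w)) (Subtype.val_injective.comp f.injective)
  refine ⟨hv.orthogonalFamily.linearIsometry.comp b.repr.toLinearIsometry, fun m hm u => ?_⟩
  have h0 : ∀ i : w, ⟪m, b (f i)⟫_ℂ = 0 := fun i => by
    have hj : ∀ j, ⟪(e j : H), b (f i)⟫_ℂ = 0 := fun j => by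
      have hmem : (e j : H) ∈ w := hsw ⟨j, rfl⟩
      have h1 : (e j : H) = b ⟨e j, hmem⟩ := by rw [hb]
      rw [h1]
      refine b.orthonormal.2 fun h => (f i).2 ?_
      change ((f i : w) : H) ∈ s
      rw [← h]
      exact ⟨j, rfl⟩
    have h2 : m = ∑ j, e.repr ⟨m, hm⟩ j • (e j : H) := by
      have := congrArg Subtype.val (e.sum_repr ⟨m, hm⟩)
      simpa using this.symm
    rw [h2, sum_inner]
    exact Finset.sum_eq_zero fun j _ => by rw [inner_smul_left, hj, mul_zero]
  have h3 := (hv.orthogonalFamily.hasSum_linearIsometry (b.repr u)).mapL (innerSL ℂ m)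
  have h4 : (fun i => innerSL ℂ m ((LinearIsometry.toSpanSingleton ℂ H (hv.1 i)) (b.repr u i))) =
      fun _ => (0 : ℂ) := by
    ext i
    simp [h0]
  rw [h4] at h3
  exact h3.unique hasSum_zero

/-- A contraction `B` can be dilated to an isometry `J` whose adjoint agrees with `B` on the
orthogonal complement of the range of an isometry `R` with `B ∘ R = 0`. -/
lemma exists_isometry_dilation {B : H →L[ℂ] H} (hB : ‖B‖ ≤ 1) (R : H →ₗᵢ[ℂ] H)
    (hBR : ∀ u, B (R u) = 0) :
    ∃ J : H →ₗᵢ[ℂ] H, ∀ ξ, (∀ u, ⟪R u, ξ⟫_ℂ = 0) → adjoint J.toContinuousLinearMap ξ = B ξ := by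
  let r : H →L[ℂ] H := R.toContinuousLinearMap
  let D := CFC.sqrt (1 - B * star B)
  have hpos : 0 ≤ 1 - B * star B := by
    rw [sub_nonneg, ← CStarAlgebra.norm_le_one_iff_of_nonneg _ (mul_star_self_nonneg B),
      CStarRing.norm_self_mul_star]
    exact mul_le_one₀ hB (norm_nonneg _) hB
  have hD : star D = D := (CFC.sqrt_nonneg (1 - B * star B)).isSelfAdjoint
  have hDD : D * D = 1 - B * star B := CFC.sqrt_mul_sqrt_self _
  have hBr : B * r = 0 := by ext u; exact hBR u
  have hrB : star r * star B = 0 := by rw [← star_mul, hBr, star_zero]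
  have hrr : star r * r = 1 := R.adjoint_comp_self
  -- The defect `D = √(1 - B B*)` is placed in the range of `R`. Since `B R = 0` the cross terms of
  -- `J₀* J₀` vanish, leaving `B B* + D² = 1`.
  let J₀ : H →L[ℂ] H := star B + r * D
  have hJs : star J₀ = B + D * star r := by simp [J₀, hD]
  have hJ : star J₀ * J₀ = 1 := by
    rw [hJs]
    calc (B + D * star r) * (star B + r * D)
        = B * star B + (B * r) * D + D * (star r * star B) + D * (star r * r) * D := by
          noncomm_ring
      _ = 1 := by rw [hBr, hrB, hrr, zero_mul, mul_zero, mul_one, hDD]; abel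
  have hJn := (norm_map_iff_adjoint_comp_self J₀).2 hJ
  refine ⟨⟨J₀.toLinearMap, hJn⟩, fun ξ hξ => ?_⟩
  have h1 : adjoint J₀ ξ = (B + D * star r) ξ := by rw [← hJs, star_eq_adjoint]
  have h2 : star r ξ = 0 := by
    refine ext_inner_left ℂ fun u => ?_
    rw [star_eq_adjoint, adjoint_inner_right, inner_zero_right]
    exact hξ u
  have h3 : (⟨J₀.toLinearMap, hJn⟩ : H →ₗᵢ[ℂ] H).toContinuousLinearMap = J₀ := rfl
  rw [h3, h1]
  simp [h2]

/-- The norm of a linear combination is controlled by the distance of the Gram matrix from the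
identity. -/
lemma norm_sum_smul_sq_le {H : Type*} [NormedAddCommGroup H] [InnerProductSpace ℂ H]
    {ι : Type*} [Fintype ι] [DecidableEq ι] (w : ι → H) (c : ι → ℂ) :
    ‖∑ i, c i • w i‖ ^ 2 ≤
      (1 + ∑ i, ∑ j, ‖⟪w i, w j⟫_ℂ - if i = j then 1 else 0‖) * ∑ i, ‖c i‖ ^ 2 := by
  set E : ι → ι → ℂ := fun i j => ⟪w i, w j⟫_ℂ - if i = j then 1 else 0
  have h1 : ((‖∑ i, c i • w i‖ ^ 2 : ℝ) : ℂ) =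
      ((∑ i, ‖c i‖ ^ 2 : ℝ) : ℂ) + ∑ i, ∑ j, starRingEnd ℂ (c i) * c j * E i j := by
    have : ((‖∑ i, c i • w i‖ ^ 2 : ℝ) : ℂ) = ⟪∑ i, c i • w i, ∑ i, c i • w i⟫_ℂ := by
      rw [inner_self_eq_norm_sq_to_K]; simp
    rw [this, sum_inner]
    have h2 : ∀ i, ⟪c i • w i, ∑ j, c j • w j⟫_ℂ =
        ((‖c i‖ ^ 2 : ℝ) : ℂ) + ∑ j, starRingEnd ℂ (c i) * c j * E i j := fun i => by
      simp only [inner_sum, inner_smul_left, inner_smul_right, E, mul_sub, Finset.sum_sub_distrib]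
      simp only [mul_ite, mul_one, mul_zero, Finset.sum_ite_eq, Finset.mem_univ, if_true,
        Complex.conj_mul', Complex.ofReal_pow, add_sub_cancel]
      exact Finset.sum_congr rfl fun _ _ => by ring
    simp only [h2, Finset.sum_add_distrib]
    push_cast
    rfl
  have hci : ∀ i, ‖c i‖ ^ 2 ≤ ∑ k, ‖c k‖ ^ 2 := fun i =>
    Finset.single_le_sum (f := fun k => ‖c k‖ ^ 2) (fun _ _ => sq_nonneg _) (Finset.mem_univ i)
  have h3 : ‖∑ i, ∑ j, starRingEnd ℂ (c i) * c j * E i j‖ ≤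
      (∑ i, ∑ j, ‖E i j‖) * ∑ k, ‖c k‖ ^ 2 := by
    rw [Finset.sum_mul]
    refine norm_sum_le_of_le _ fun i _ => ?_
    rw [Finset.sum_mul]
    refine norm_sum_le_of_le _ fun j _ => ?_
    rw [norm_mul, norm_mul, RCLike.norm_conj, mul_comm]
    gcongr
    nlinarith [hci i, hci j, sq_nonneg (‖c i‖ - ‖c j‖)]
  have h4 : ‖∑ i, c i • w i‖ ^ 2 = (∑ i, ‖c i‖ ^ 2) +
      (∑ i, ∑ j, starRingEnd ℂ (c i) * c j * E i j).re := by
    have := congrArg Complex.re h1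
    rwa [Complex.ofReal_re, Complex.add_re, Complex.ofReal_re] at this
  rw [h4, add_mul, one_mul]
  gcongr
  exact (Complex.re_le_norm _).trans h3

end HilbertSpace

/-! ### Copying a finite-dimensional compression to a nearby functional -/

section Compression

variable {A H : Type*} [NonUnitalCStarAlgebra A]
  [NormedAddCommGroup H] [InnerProductSpace ℂ H] [CompleteSpace H]
  {ι : Type*} [Fintype ι] [DecidableEq ι]

open CStarRep

/-- The covariances `φ(b i* b j) - conj (φ (b i)) φ (b j)`. -/
noncomputable def covariance (b : ι → A) (φ : WeakDual ℂ A) (i j : ι) : ℂ :=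
  φ (star (b i) * b j) - starRingEnd ℂ (φ (b i)) * φ (b j)

/-- A normalisation factor, equal to one when the covariance matrix is the identity. -/
noncomputable def covarianceScale (b : ι → A) (φ : WeakDual ℂ A) : ℝ :=
  (√(1 + ∑ i, ∑ j, ‖covariance b φ i j - if i = j then 1 else 0‖))⁻¹

/-- The vector `x` together with the centred vectors `π (b j) x - φ (b j) x`. -/
noncomputable def centredVectors (π : CStarRep A H) (x : H) (b : ι → A) (φ : WeakDual ℂ A) :
    Option ι → H
  | none => x
  | some j => π (b j) x - φ (b j) • x

/-- The matrix coefficients of `π a` at the centred vectors. -/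
noncomputable def centredCoeff (b : ι → A) (φ : WeakDual ℂ A) (a : A) : Option ι → Option ι → ℂ
  | none, none => φ a
  | none, some j => φ (a * b j) - φ (b j) * φ a
  | some i, none => φ (star (b i) * a) - starRingEnd ℂ (φ (b i)) * φ a
  | some i, some j => φ (star (b i) * (a * b j)) - φ (b j) * φ (star (b i) * a) -
      starRingEnd ℂ (φ (b i)) * (φ (a * b j) - φ (b j) * φ a)

/-- The weights of the centred vectors in `centredOperator`. -/
noncomputable def centredWeight (b : ι → A) (φ : WeakDual ℂ A) : Option ι → ℝ
  | none => 1
  | some _ => covarianceScale b φ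

/-- The operator sending `u o` to the weighted centred vector with index `o`. -/
noncomputable def centredOperator (u : Option ι → H) (π : CStarRep A H) (x : H) (b : ι → A)
    (φ : WeakDual ℂ A) : H →L[ℂ] H :=
  ∑ o, (centredWeight b φ o : ℂ) • InnerProductSpace.rankOne ℂ (centredVectors π x b φ o) (u o)

omit [DecidableEq ι] [Fintype ι] in
lemma inner_centredVectors {π : CStarRep A H} {x : H} {φ : WeakDual ℂ A} (h : π.Realizes x φ)
    (b : ι → A) (a : A) (o o' : Option ι) :
    ⟪centredVectors π x b φ o, π a (centredVectors π x b φ o')⟫_ℂ = centredCoeff b φ a o o' := by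
  have h1 : ∀ a, ⟪x, π a x⟫_ℂ = φ a := fun a => (h a).symm
  have h2 : ∀ a c, ⟪x, π a (π c x)⟫_ℂ = φ (a * c) := fun a c => by
    rw [← mul_apply_eq_comp, ← map_mul, h1]
  have h3 : ∀ a c, ⟪π a x, π c x⟫_ℂ = φ (star a * c) := fun a c => h.inner_apply_apply a c
  have h4 : ∀ a c d, ⟪π a x, π c (π d x)⟫_ℂ = φ (star a * (c * d)) := fun a c d => by
    rw [← mul_apply_eq_comp, ← map_mul, h3]
  cases o <;> cases o' <;>
    simp only [centredVectors, centredCoeff, map_sub, map_smul, inner_sub_left, inner_sub_right,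
      inner_smul_left, inner_smul_right, h1, h2, h3, h4]
  ring

omit [DecidableEq ι] [Fintype ι] in
lemma inner_centredVectors_some {π : CStarRep A H} {x : H} {φ : WeakDual ℂ A}
    (h : π.Realizes x φ) (hx : ‖x‖ = 1) (b : ι → A) (i j : ι) :
    ⟪centredVectors π x b φ (some i), centredVectors π x b φ (some j)⟫_ℂ =
      covariance b φ i j := by
  have h1 : ∀ a, ⟪x, π a x⟫_ℂ = φ a := fun a => (h a).symm
  have h2 : ∀ a, ⟪π a x, x⟫_ℂ = starRingEnd ℂ (φ a) := fun a => by rw [← inner_conj_symm, h1]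
  have h3 : ⟪x, x⟫_ℂ = 1 := inner_self_eq_one_of_norm_eq_one hx
  simp only [centredVectors, covariance, inner_sub_left, inner_sub_right, inner_smul_left,
    inner_smul_right, h1, h2, h3, h.inner_apply_apply]
  ring

omit [DecidableEq ι] [Fintype ι] in
lemma inner_centredVectors_none {π : CStarRep A H} {x : H} {φ : WeakDual ℂ A}
    (h : π.Realizes x φ) (hx : ‖x‖ = 1) (b : ι → A) (j : ι) :
    ⟪x, centredVectors π x b φ (some j)⟫_ℂ = 0 := by
  rw [centredVectors, inner_sub_right, inner_smul_right, inner_self_eq_one_of_norm_eq_one hx,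
    ← h, mul_one, sub_self]

lemma centredOperator_apply (u : Option ι → H) (π : CStarRep A H) (x : H) (b : ι → A)
    (φ : WeakDual ℂ A) (ξ : H) : centredOperator u π x b φ ξ =
      ∑ o, ((centredWeight b φ o : ℂ) * ⟪u o, ξ⟫_ℂ) • centredVectors π x b φ o := by
  simp only [centredOperator, sum_apply, smul_apply, InnerProductSpace.rankOne_apply, smul_smul]

lemma inner_centredOperator {π : CStarRep A H} {x : H} {φ : WeakDual ℂ A} (h : π.Realizes x φ)
    (u : Option ι → H) (b : ι → A) (a : A) (ξ η : H) :
    ⟪centredOperator u π x b φ η, π a (centredOperator u π x b φ ξ)⟫_ℂ =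
      ∑ o, ∑ o', ((centredWeight b φ o : ℂ) * ⟪η, u o⟫_ℂ) *
        (((centredWeight b φ o' : ℂ) * ⟪u o', ξ⟫_ℂ) * centredCoeff b φ a o o') := by
  simp only [centredOperator_apply, map_sum, map_smul, sum_inner, inner_sum, inner_smul_left,
    inner_smul_right, inner_centredVectors h, map_mul, Complex.conj_ofReal, inner_conj_symm]
  simp only [Finset.mul_sum]
  rw [Finset.sum_comm]
  exact Finset.sum_congr rfl fun o _ => Finset.sum_congr rfl fun o' _ => by ring

/-- Centring makes `x` orthogonal to the other vectors, so only those need rescaling. Their Gram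
matrix is the covariance matrix, whose distance from the identity is compensated by
`covarianceScale`; Bessel's inequality finishes. -/
lemma norm_centredOperator_le {π : CStarRep A H} {x : H} {φ : WeakDual ℂ A} (h : π.Realizes x φ)
    (hx : ‖x‖ = 1) {u : Option ι → H} (hu : Orthonormal ℂ u) (b : ι → A) :
    ‖centredOperator u π x b φ‖ ≤ 1 := by
  refine opNorm_le_bound _ zero_le_one fun ξ => ?_
  rw [one_mul]
  set w : ι → H := fun j => centredVectors π x b φ (some j)
  set K : ℝ := 1 + ∑ i, ∑ j, ‖covariance b φ i j - if i = j then 1 else 0‖ with hK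
  have hK1 : 0 < K := by positivity
  have hs : covarianceScale b φ ^ 2 = K⁻¹ := by
    rw [covarianceScale, inv_pow, Real.sq_sqrt hK1.le]
  set y : H := ∑ j, ⟪u (some j), ξ⟫_ℂ • w j with hy
  have hyn : ‖y‖ ^ 2 ≤ K * ∑ j, ‖⟪u (some j), ξ⟫_ℂ‖ ^ 2 := by
    have := norm_sum_smul_sq_le w fun j => ⟪u (some j), ξ⟫_ℂ
    simpa only [w, inner_centredVectors_some h hx] using this
  have hxy : ⟪x, y⟫_ℂ = 0 := by
    rw [hy, inner_sum]
    exact Finset.sum_eq_zero fun j _ => by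
      rw [inner_smul_right, inner_centredVectors_none h hx, mul_zero]
  have h1 : centredOperator u π x b φ ξ = ⟪u none, ξ⟫_ℂ • x + (covarianceScale b φ : ℂ) • y := by
    rw [centredOperator_apply, Fintype.sum_option, hy, Finset.smul_sum]
    simp [centredWeight, centredVectors, w, smul_smul]
  have h2 : ‖centredOperator u π x b φ ξ‖ ^ 2 =
      ‖⟪u none, ξ⟫_ℂ‖ ^ 2 + covarianceScale b φ ^ 2 * ‖y‖ ^ 2 := by
    rw [h1, sq, norm_add_sq_eq_norm_sq_add_norm_sq_of_inner_eq_zero _ _ (by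
      rw [inner_smul_left, inner_smul_right, hxy, mul_zero, mul_zero])]
    rw [norm_smul, norm_smul, hx, Complex.norm_real, Real.norm_eq_abs, ← sq_abs (covarianceScale b φ)]
    ring
  have h3 : ‖⟪u none, ξ⟫_ℂ‖ ^ 2 + ∑ j, ‖⟪u (some j), ξ⟫_ℂ‖ ^ 2 ≤ ‖ξ‖ ^ 2 := by
    have := hu.sum_inner_products_le ξ (s := Finset.univ)
    rwa [Fintype.sum_option] at this
  have h4 : covarianceScale b φ ^ 2 * ‖y‖ ^ 2 ≤ ∑ j, ‖⟪u (some j), ξ⟫_ℂ‖ ^ 2 := by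
    rw [hs, inv_mul_le_iff₀ hK1]
    exact hyn
  exact abs_le_of_sq_le_sq' (by linarith) (norm_nonneg _) |>.2

lemma centredOperator_apply_none (π : CStarRep A H) (x : H) (φ : WeakDual ℂ A)
    {u : Option ι → H} (hu : Orthonormal ℂ u) (b : ι → A) :
    centredOperator u π x b φ (u none) = x := by
  rw [centredOperator_apply, Fintype.sum_option]
  have h1 : ∀ j, ⟪u (some j), u none⟫_ℂ = 0 := fun j => hu.2 (by simp)
  simp [h1, centredWeight, centredVectors, hu.1 none]

lemma continuous_covarianceScale (b : ι → A) : Continuous (covarianceScale b) := by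
  have he : ∀ a : A, Continuous fun φ : WeakDual ℂ A => φ a := WeakDual.eval_continuous
  have hc : ∀ i j, Continuous fun φ => covariance b φ i j := fun i j =>
    (he _).sub ((Complex.continuous_conj.comp (he _)).mul (he _))
  refine Continuous.inv₀ (Real.continuous_sqrt.comp (continuous_const.add
    (continuous_finsetSum _ fun i _ => continuous_finsetSum _ fun j _ =>
      ((hc i j).sub continuous_const).norm))) fun φ => ?_
  refine Real.sqrt_ne_zero'.2 ?_
  positivity

omit [CompleteSpace H] in
-- By `inner_centredOperator` these are the coefficients of the compressed representation; they
-- involve `(π, x)` only through finitely many values of `φ`.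
lemma continuous_centredSum (u : Option ι → H) (b : ι → A) (a : A) (ξ η : H) :
    Continuous fun φ : WeakDual ℂ A =>
      ∑ o, ∑ o', ((centredWeight b φ o : ℂ) * ⟪η, u o⟫_ℂ) *
        (((centredWeight b φ o' : ℂ) * ⟪u o', ξ⟫_ℂ) * centredCoeff b φ a o o') := by
  have he : ∀ a : A, Continuous fun φ : WeakDual ℂ A => φ a := WeakDual.eval_continuous
  have hw : ∀ o, Continuous fun φ : WeakDual ℂ A => (centredWeight b φ o : ℂ) := fun o => by
    rcases o with _ | i
    · exact continuous_const (y := ((1 : ℝ) : ℂ))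
    · exact Complex.continuous_ofReal.comp (continuous_covarianceScale b)
  have hc : ∀ o o', Continuous fun φ : WeakDual ℂ A => centredCoeff b φ a o o' := fun o o' => by
    have hconj : ∀ a : A, Continuous fun φ : WeakDual ℂ A => starRingEnd ℂ (φ a) := fun a =>
      Complex.continuous_conj.comp (he a)
    rcases o with _ | i <;> rcases o' with _ | j <;> simp only [centredCoeff]
    · exact he a
    · exact (he _).sub ((he _).mul (he _))
    · exact (he _).sub ((hconj _).mul (he _))
    · exact ((he _).sub ((he _).mul (he _))).sub
        ((hconj _).mul ((he _).sub ((he _).mul (he _))))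
  exact continuous_finsetSum _ fun o _ => continuous_finsetSum _ fun o' _ =>
    ((hw o).mul continuous_const).mul (((hw o').mul continuous_const).mul (hc o o'))

/-- If the centred vectors are orthonormal, they define a projection. -/
lemma centredOperator_self {π : CStarRep A H} {x : H} {φ : WeakDual ℂ A} (h : π.Realizes x φ)
    {b : ι → A} (hu : Orthonormal ℂ (centredVectors π x b φ)) (ξ : H) :
    centredOperator (centredVectors π x b φ) π x b φ ξ =
      ∑ o, ⟪centredVectors π x b φ o, ξ⟫_ℂ • centredVectors π x b φ o := by
  have hx : ‖x‖ = 1 := hu.1 none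
  have hs : covarianceScale b φ = 1 := by
    have : ∀ i j, covariance b φ i j = if i = j then 1 else 0 := fun i j => by
      rw [← inner_centredVectors_some h hx, orthonormal_iff_ite.1 hu]
      simp
    simp [covarianceScale, this]
  rw [centredOperator_apply]
  refine Finset.sum_congr rfl fun o _ => ?_
  cases o <;> simp [centredWeight, hs]

end Compression

/-! ### Continuity in infinite dimension, by dilation -/

section InfiniteDimensional

variable {A : Type u} [NonUnitalCStarAlgebra A]
  {H : Type v} [NormedAddCommGroup H] [InnerProductSpace ℂ H] [CompleteSpace H]

open CStarRep

/-- In infinite dimension, quasi-states are vector functionals of unit vectors. -/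
lemma IsQuasiState.exists_realizes_unit (hinf : ¬ FiniteDimensional ℂ H)
    (hH : StrictlyContainsCyclicReps A H) {φ : WeakDual ℂ A} (hφ : IsQuasiState φ) :
    ∃ (π : CStarRep A H) (x : H), ‖x‖ = 1 ∧ π.Realizes x φ ∧
      ∀ ξ, (∀ b, ⟪π b x, ξ⟫_ℂ = 0) → ∀ a, π a ξ = 0 := by
  obtain ⟨π, x, hx, hr, hd⟩ := hφ.exists_realizes hH
  have : Nontrivial H := by
    by_contra h
    rw [not_nontrivial_iff_subsingleton] at h
    exact hinf inferInstance
  obtain ⟨e, he⟩ := exists_norm_eq H zero_le_one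
  obtain ⟨R, hR⟩ := exists_isometry_orthogonal hinf (Submodule.span ℂ {e})
  have hRe : ∀ u, ⟪e, R u⟫_ℂ = 0 := hR e (Submodule.mem_span_singleton_self e)
  have hRe' : adjoint R.toContinuousLinearMap e = 0 := by
    refine ext_inner_right ℂ fun u => ?_
    rw [adjoint_inner_left, inner_zero_left]
    exact hRe u
  -- The missing norm is supplied along `e`, on which the transported representation vanishes.
  let s : ℝ := √(1 - ‖x‖ ^ 2)
  have hs : s ^ 2 = 1 - ‖x‖ ^ 2 := Real.sq_sqrt (by nlinarith [norm_nonneg x])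
  have hRx : adjoint R.toContinuousLinearMap (R x + (s : ℂ) • e) = x := by
    rw [map_add, map_smul, adjoint_isometry_apply, hRe', smul_zero, add_zero]
  refine ⟨conjIsometry R π, R x + (s : ℂ) • e, ?_, fun a => ?_, fun ξ hξ a => ?_⟩
  · have h1 : ‖R x + (s : ℂ) • e‖ ^ 2 = 1 := by
      rw [sq, norm_add_sq_eq_norm_sq_add_norm_sq_of_inner_eq_zero _ _ (by
        rw [inner_smul_right, ← inner_conj_symm, hRe, map_zero, mul_zero])]
      rw [R.norm_map, norm_smul, he, Complex.norm_real, mul_one, Real.norm_eq_abs, abs_mul_abs_self,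
        ← sq, ← sq, hs]
      ring
    exact (pow_eq_one_iff_of_nonneg (norm_nonneg _) two_ne_zero).1 h1
  · rw [inner_conjIsometry, hRx, hr]
  · rw [conjIsometry_apply, hd _ fun b => ?_, map_zero]
    rw [adjoint_inner_right]
    have := hξ b
    rwa [conjIsometry_apply, hRx] at this

/-- The finite-dimensional subspace spanned by `z` and finitely many vectors of its orbit. -/
noncomputable def orbitSpan (π : CStarRep A H) (z : H) (s : Finset A) : Submodule ℂ H :=
  Submodule.span ℂ (insert z ((fun b => π b z) '' s))

instance (π : CStarRep A H) (z : H) (s : Finset A) : FiniteDimensional ℂ (orbitSpan π z s) :=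
  FiniteDimensional.span_of_finite ℂ ((s.finite_toSet.image _).insert z)

lemma monotone_orbitSpan (π : CStarRep A H) (z : H) : Monotone (orbitSpan π z) := fun _ _ hst =>
  Submodule.span_mono (Set.insert_subset_insert (Set.image_mono hst))

lemma mem_orbitSpan_self (π : CStarRep A H) (z : H) (s : Finset A) : z ∈ orbitSpan π z s :=
  Submodule.subset_span (Set.mem_insert _ _)

lemma exists_eq_of_mem_orbitSpan {π : CStarRep A H} {z : H} {s : Finset A} {n : H}
    (hn : n ∈ orbitSpan π z s) : ∃ (b : A) (c : ℂ), n = π b z + c • z := by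
  induction hn using Submodule.span_induction with
  | mem x hx =>
    rcases hx with rfl | ⟨b, -, rfl⟩
    · exact ⟨0, 1, by simp⟩
    · exact ⟨b, 0, by simp⟩
  | zero => exact ⟨0, 0, by simp⟩
  | add x y _ _ hx hy =>
    obtain ⟨b, c, rfl⟩ := hx
    obtain ⟨b', c', rfl⟩ := hy
    exact ⟨b + b', c + c', by simp [add_smul]; abel⟩
  | smul r x _ hx =>
    obtain ⟨b, c, rfl⟩ := hx
    exact ⟨r • b, r * c, by simp [mul_smul]⟩

/-- The subspace `orbitSpan π z s` has an orthonormal basis made of centred vectors. -/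
lemma exists_orthonormal_centredVectors {π : CStarRep A H} {z : H} {φ : WeakDual ℂ A}
    (h : π.Realizes z φ) (hz : ‖z‖ = 1) (s : Finset A) :
    ∃ (n : ℕ) (b : Fin n → A), Orthonormal ℂ (centredVectors π z b φ) ∧
      (∀ o, centredVectors π z b φ o ∈ orbitSpan π z s) ∧
      ∀ ξ, (orbitSpan π z s).starProjection ξ =
        ∑ o, ⟪centredVectors π z b φ o, ξ⟫_ℂ • centredVectors π z b φ o := by
  set N := orbitSpan π z s
  have hzN : z ∈ N := mem_orbitSpan_self π z s
  let N' : Submodule ℂ H := N ⊓ (ℂ ∙ z)ᗮ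
  have : FiniteDimensional ℂ N' := Submodule.finiteDimensional_of_le inf_le_left
  let e := stdOrthonormalBasis ℂ N'
  have heN : ∀ j, (e j : H) ∈ N := fun j => (e j).2.1
  have hez : ∀ j, ⟪z, (e j : H)⟫_ℂ = 0 := fun j =>
    Submodule.mem_orthogonal_singleton_iff_inner_right.1 (e j).2.2
  have hzz : ⟪z, z⟫_ℂ = 1 := inner_self_eq_one_of_norm_eq_one hz
  choose b c hb using fun j => exists_eq_of_mem_orbitSpan (heN j)
  -- Orthogonality to the unit vector `z` forces this coefficient, so the basis vectors are centred.
  have hc : ∀ j, c j = -φ (b j) := fun j => by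
    have := hez j
    rw [hb, inner_add_right, inner_smul_right, hzz, ← h, mul_one] at this
    linear_combination this
  have hv : ∀ j, centredVectors π z b φ (some j) = e j := fun j => by
    rw [centredVectors, hb, hc, neg_smul, sub_eq_add_neg]
  have hv0 : centredVectors π z b φ none = z := rfl
  have heo : Orthonormal ℂ fun j => (e j : H) := e.orthonormal.comp_linearIsometry N'.subtypeₗᵢ
  have hmem : ∀ o, centredVectors π z b φ o ∈ N := by
    rintro (_ | j)
    · exact hzN
    · rw [hv]; exact heN j
  have hon : Orthonormal ℂ (centredVectors π z b φ) := by
    refine ⟨?_, ?_⟩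
    · rintro (_ | j)
      · exact hz
      · rw [hv]; exact heo.1 j
    · rintro (_ | i) (_ | j) hij
      · exact absurd rfl hij
      · rw [hv, hv0, hez]
      · rw [hv, hv0, ← inner_conj_symm, hez, map_zero]
      · rw [hv, hv]; exact heo.2 fun h => hij (by rw [h])
  refine ⟨_, b, hon, hmem, fun ξ => ?_⟩
  refine Submodule.eq_starProjection_of_mem_of_inner_eq_zero
    (Submodule.sum_mem _ fun o _ => Submodule.smul_mem _ _ (hmem o)) fun w hw => ?_
  have h1 : ∀ o, ⟪ξ - ∑ o, ⟪centredVectors π z b φ o, ξ⟫_ℂ • centredVectors π z b φ o,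
      centredVectors π z b φ o⟫_ℂ = 0 := fun o => by
    rw [inner_sub_left, sum_inner]
    simp only [inner_smul_left, inner_conj_symm, orthonormal_iff_ite.1 hon]
    simp
  have hw' : w - ⟪z, w⟫_ℂ • z ∈ N' :=
    Submodule.mem_inf.2 ⟨Submodule.sub_mem _ hw (Submodule.smul_mem _ _ hzN),
      Submodule.mem_orthogonal_singleton_iff_inner_right.2 (by
        rw [inner_sub_right, inner_smul_right, hzz, mul_one, sub_self])⟩
  obtain ⟨c₀, c', rfl⟩ : ∃ (c₀ : ℂ) (c' : Fin (Module.finrank ℂ N') → ℂ),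
      w = c₀ • z + ∑ j, c' j • (e j : H) := by
    refine ⟨⟪z, w⟫_ℂ, fun j => e.repr ⟨_, hw'⟩ j, ?_⟩
    rw [← sub_eq_iff_eq_add']
    refine (congrArg Subtype.val (e.sum_repr ⟨_, hw'⟩)).symm.trans ?_
    simp
  have hz1 := h1 none
  have he1 := fun j => h1 (some j)
  simp only [hv] at he1
  generalize ξ - ∑ o, ⟪centredVectors π z b φ o, ξ⟫_ℂ • centredVectors π z b φ o = η at hz1 he1 ⊢
  rw [inner_add_right, inner_sum, inner_smul_right, show ⟪η, z⟫_ℂ = 0 from hz1, mul_zero, zero_add]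
  exact Finset.sum_eq_zero fun j _ => by rw [inner_smul_right, he1, mul_zero]

/-- The compressions of `π a` to the subspaces `orbitSpan π z s` converge weakly to `π a`. -/
lemma tendsto_inner_compression {π : CStarRep A H} {z : H}
    (hd : ∀ ξ, (∀ b, ⟪π b z, ξ⟫_ℂ = 0) → ∀ a, π a ξ = 0) (a : A) (ξ η : H) :
    Tendsto (fun s => ⟪(orbitSpan π z s).starProjection η,
      π a ((orbitSpan π z s).starProjection ξ)⟫_ℂ) atTop (𝓝 ⟪η, π a ξ⟫_ℂ) := by
  let K := (⨆ s, orbitSpan π z s).topologicalClosure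
  have : CompleteSpace K := (Submodule.isClosed_topologicalClosure _).completeSpace_coe
  have hlim : ∀ ξ, Tendsto (fun s => (orbitSpan π z s).starProjection ξ) atTop
      (𝓝 (K.starProjection ξ)) := fun ξ =>
    Submodule.starProjection_tendsto_closure_iSup _ (monotone_orbitSpan π z) ξ
  have hK : ∀ b, π b z ∈ K := fun b => by
    refine Submodule.le_topologicalClosure _ (le_iSup (orbitSpan π z) {b} ?_)
    exact Submodule.subset_span (Set.mem_insert_of_mem _ ⟨b, by simp, rfl⟩)
  -- By `hd`, the representation kills the complement of the orbit, so compressing to `K` loses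
  -- nothing.
  have hP : ∀ a ξ, π a (K.starProjection ξ) = π a ξ := fun a ξ => by
    have h1 : ∀ b, ⟪π b z, ξ - K.starProjection ξ⟫_ℂ = 0 := fun b =>
      Submodule.inner_right_of_mem_orthogonal (hK b) (K.sub_starProjection_mem_orthogonal ξ)
    have := hd _ h1 a
    rw [map_sub, sub_eq_zero] at this
    exact this.symm
  have h2 : ⟪η, π a ξ⟫_ℂ = ⟪K.starProjection η, π a (K.starProjection ξ)⟫_ℂ := by
    rw [hP, inner_apply_right, inner_apply_right, hP]
  rw [h2]
  exact (hlim η).inner (((π a).continuous.tendsto _).comp (hlim ξ))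

/-- In infinite dimension, quasi-states close to a vector functional of `(π₀, z)` are vector
functionals of `(π, z)` with `π` close to `π₀`. -/
lemma eventually_exists_realizes (hinf : ¬ FiniteDimensional ℂ H)
    (hH : StrictlyContainsCyclicReps A H) {φ₀ : WeakDual ℂ A} {π₀ : CStarRep A H} {z : H}
    (hz : ‖z‖ = 1) (h₀ : π₀.Realizes z φ₀)
    (hd : ∀ ξ, (∀ b, ⟪π₀ b z, ξ⟫_ℂ = 0) → ∀ a, π₀ a ξ = 0) {U : Set (CStarRep A H)}
    (hU : U ∈ 𝓝 π₀) :
    ∀ᶠ (φ : WeakDual ℂ A) in 𝓝[{φ : WeakDual ℂ A | IsQuasiState φ}] φ₀, ∃ π ∈ U, π.Realizes z φ := by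
  rw [isInducing_coeff.nhds_eq_comap, mem_comap] at hU
  obtain ⟨W, hW, hWU⟩ := hU
  rw [nhds_pi, Filter.mem_pi] at hW
  obtain ⟨I, hI, t, ht, hIt⟩ := hW
  have h1 : ∀ᶠ s in atTop, ∀ i ∈ I, t i ∈ 𝓝 ⟪(orbitSpan π₀ z s).starProjection i.2.2,
      π₀ i.1 ((orbitSpan π₀ z s).starProjection i.2.1)⟫_ℂ := by
    rw [eventually_all_finite hI]
    exact fun i _ => (tendsto_inner_compression hd i.1 i.2.1 i.2.2).eventually
      (eventually_mem_nhds_iff.2 (ht i))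
  obtain ⟨s, hs⟩ := h1.exists
  obtain ⟨n, b, hon, hmem, hproj⟩ := exists_orthonormal_centredVectors h₀ hz s
  set u := centredVectors π₀ z b φ₀ with hu
  -- `M` also contains the test vectors of the neighbourhood, so that the adjoint of the dilation
  -- equals `B` on all of them.
  let M := orbitSpan π₀ z s ⊔ Submodule.span ℂ
    ((fun i : A × H × H => i.2.1) '' I ∪ (fun i : A × H × H => i.2.2) '' I)
  have : FiniteDimensional ℂ (Submodule.span ℂ
      ((fun i : A × H × H => i.2.1) '' I ∪ (fun i : A × H × H => i.2.2) '' I)) :=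
    FiniteDimensional.span_of_finite ℂ ((hI.image _).union (hI.image _))
  obtain ⟨R, hR⟩ := exists_isometry_orthogonal hinf M
  have hR' : ∀ m ∈ M, ∀ u, ⟪R u, m⟫_ℂ = 0 := fun m hm u => by
    rw [← inner_conj_symm, hR m hm, map_zero]
  have huM : ∀ o, u o ∈ M := fun o => Submodule.mem_sup_left (hmem o)
  have h2 : ∀ i ∈ I, ∀ᶠ (φ : WeakDual ℂ A) in 𝓝[{φ : WeakDual ℂ A | IsQuasiState φ}] φ₀,
      (∑ o, ∑ o', ((centredWeight b φ o : ℂ) * ⟪i.2.2, u o⟫_ℂ) *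
        (((centredWeight b φ o' : ℂ) * ⟪u o', i.2.1⟫_ℂ) * centredCoeff b φ i.1 o o')) ∈ t i := by
    intro i hi
    refine ((continuous_centredSum u b i.1 i.2.1 i.2.2).tendsto φ₀).mono_left
      nhdsWithin_le_nhds |>.eventually ?_
    -- At `φ₀` itself the operator is the projection onto `orbitSpan π₀ z s`, and the sum is the
    -- compressed coefficient controlled by `hs`.
    rw [← inner_centredOperator h₀ u, hu, centredOperator_self h₀ hon, centredOperator_self h₀ hon,
      ← hproj, ← hproj]
    exact hs i hi
  filter_upwards [(eventually_all_finite hI).2 h2, self_mem_nhdsWithin] with φ hφ hφQ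
  obtain ⟨π', x', hx', hr', -⟩ := IsQuasiState.exists_realizes_unit hinf hH hφQ
  let B := centredOperator u π' x' b φ
  have hBR : ∀ v, B (R v) = 0 := fun v => by
    simp only [B, centredOperator_apply]
    exact Finset.sum_eq_zero fun o _ => by rw [hR _ (huM o), mul_zero, zero_smul]
  obtain ⟨J, hJ⟩ := exists_isometry_dilation (norm_centredOperator_le hr' hx' hon b) R hBR
  have hJM : ∀ m ∈ M, adjoint J.toContinuousLinearMap m = B m := fun m hm => hJ m (hR' m hm)
  refine ⟨conjIsometry J π', hWU (hIt fun i hi => ?_), fun a => ?_⟩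
  · have h3 : i.2.1 ∈ M := Submodule.mem_sup_right (Submodule.subset_span (.inl ⟨i, hi, rfl⟩))
    have h4 : i.2.2 ∈ M := Submodule.mem_sup_right (Submodule.subset_span (.inr ⟨i, hi, rfl⟩))
    simp only
    rw [inner_conjIsometry, hJM _ h3, hJM _ h4, inner_centredOperator hr']
    exact hφ i hi
  -- The weight of `none` is exactly one, so `z` is sent to `x'` and `φ` is realized exactly, not
  -- approximately.
  · have h5 : adjoint J.toContinuousLinearMap z = x' := by
      rw [hJM z (huM none)]
      exact centredOperator_apply_none π' x' φ hon b
    rw [inner_conjIsometry, h5, hr']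

/-- The realizing vector `z` stays fixed while the representation moves, so continuity of the single
coefficient `⟪z, T π z⟫` at `π₀` suffices. -/
lemma IsContinuousField.continuousOn_of_infiniteDimensional (hinf : ¬ FiniteDimensional ℂ H)
    {T : CStarRep A H → (H →L[ℂ] H)} (hT : IsContinuousField T)
    (hH : StrictlyContainsCyclicReps A H) :
    ContinuousOn (fieldFunctional T) {φ : WeakDual ℂ A | IsQuasiState φ} := by
  intro φ₀ hφ₀ V hV
  obtain ⟨π₀, z, hz, h₀, hd⟩ := IsQuasiState.exists_realizes_unit hinf hH hφ₀
  rw [hT.fieldFunctional_eq h₀] at hV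
  rw [Filter.mem_map]
  filter_upwards [eventually_exists_realizes hinf hH hz h₀ hd
    ((hT.continuous_inner z z).continuousAt hV)] with φ ⟨π, hπ, hr⟩
  rw [Set.mem_preimage, hT.fieldFunctional_eq hr]
  exact hπ

end InfiniteDimensional

/-! ### Takesaki duality -/

section Takesaki

variable {A : Type u} [NonUnitalCStarAlgebra A]
  {H : Type v} [NormedAddCommGroup H] [InnerProductSpace ℂ H] [CompleteSpace H]

open CStarRep

namespace IsContinuousField

variable {T : CStarRep A H → (H →L[ℂ] H)}

lemma continuousOn_fieldFunctional (hT : IsContinuousField T)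
    (hH : StrictlyContainsCyclicReps A H) :
    ContinuousOn (fieldFunctional T) {φ : WeakDual ℂ A | IsQuasiState φ} := by
  by_cases hfin : FiniteDimensional ℂ H
  · exact hT.continuousOn_of_finiteDimensional hH
  · exact hT.continuousOn_of_infiniteDimensional hfin hH

/-- A field whose quadratic forms agree with those of `a` on unit balls is evaluation at `a`. -/
lemma eq_eval_of_fieldFunctional (hT : IsContinuousField T) {a : A}
    (ha : ∀ φ, IsQuasiState φ → φ a = fieldFunctional T φ) (π : CStarRep A H) : T π = π a := by
  refine coe_injective ((ext_inner_map (T π : H →ₗ[ℂ] H) (π a : H →ₗ[ℂ] H)).1 fun x => ?_)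
  have hunit : ∀ y : H, ‖y‖ ≤ 1 → ⟪y, T π y⟫_ℂ = ⟪y, π a y⟫_ℂ := fun y hy => by
    rw [← hT.fieldFunctional_eq (π.realizes_vectorFunctional y),
      ← ha _ (π.isQuasiState_vectorFunctional hy), π.realizes_vectorFunctional y]
  suffices h : ⟪x, T π x⟫_ℂ = ⟪x, π a x⟫_ℂ by
    have := congrArg (starRingEnd ℂ) h
    rwa [inner_conj_symm, inner_conj_symm] at this
  rcases eq_or_ne x 0 with rfl | hx
  · simp
  have hx' : (‖x‖ : ℂ) ≠ 0 := by simpa using hx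
  have h := hunit ((‖x‖ : ℂ)⁻¹ • x) (by
    rw [norm_smul, norm_inv, Complex.norm_real, norm_norm, inv_mul_cancel₀ (norm_ne_zero_iff.2 hx)])
  simp only [map_smul, inner_smul_left, inner_smul_right] at h
  exact mul_left_cancel₀ ((map_ne_zero _).2 (inv_ne_zero hx'))
    (mul_left_cancel₀ (inv_ne_zero hx') h)

/-- Selfadjoint values make the induced function real on quasi-states, as Kadison's representation
requires. -/
lemma exists_eq_eval_of_star_eq (hT : IsContinuousField T) (hH : StrictlyContainsCyclicReps A H)
    (hs : ∀ π, star (T π) = T π) : ∃ a : A, ∀ π, T π = π a := by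
  have hre : ∀ φ : WeakDual ℂ A, IsQuasiState φ →
      ((fieldFunctional T φ).re : ℂ) = fieldFunctional T φ := fun φ hφ => by
    obtain ⟨π, x, -, h, -⟩ := hφ.exists_realizes hH
    rw [hT.fieldFunctional_eq h, ← Complex.conj_eq_iff_re, inner_conj_symm]
    conv_lhs => rw [← hs π, star_eq_adjoint, adjoint_inner_left]
  obtain ⟨a, ha⟩ := exists_apply_eq_of_affine (f := fun φ => (fieldFunctional T φ).re)
    (Complex.continuous_re.comp_continuousOn (hT.continuousOn_fieldFunctional hH))
    (fun φ ψ hφ hψ s t hs ht hst => by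
      rw [hT.fieldFunctional_affine hH hφ hψ hs ht hst]
      simp)
    (by simp only [hT.fieldFunctional_zero, Complex.zero_re])
  exact ⟨a, hT.eq_eval_of_fieldFunctional fun φ hφ => (ha φ hφ).trans (hre φ hφ)⟩

/-- Takesaki's duality: a continuous field is evaluation at an element of the algebra. -/
lemma exists_eq_eval (hT : IsContinuousField T) (hH : StrictlyContainsCyclicReps A H) :
    ∃ a : A, ∀ π, T π = π a := by
  obtain ⟨a, ha⟩ := (hT.add hT.star).exists_eq_eval_of_star_eq hH fun π => by
    rw [star_add, star_star, add_comm]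
  obtain ⟨b, hb⟩ := ((hT.smul Complex.I).add (hT.smul Complex.I).star).exists_eq_eval_of_star_eq hH
    fun π => by rw [star_add, star_star, add_comm]
  -- `a` represents `T + T*` and `b` represents `iT - iT*`, so `a - i b` represents `2T`.
  refine ⟨(2⁻¹ : ℂ) • (a - Complex.I • b), fun π => ?_⟩
  rw [map_smul, map_sub, map_smul, ← ha, ← hb, star_smul, Complex.star_def, Complex.conj_I,
    smul_add, smul_smul, smul_smul, mul_neg, Complex.I_mul_I, neg_neg, neg_smul, one_smul]
  module

end IsContinuousField

/-- The norm of `A` is attained at a representation on `H`. -/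
lemma exists_norm_le_norm_apply (hH : StrictlyContainsCyclicReps A H) (a : A) :
    ∃ π : CStarRep A H, ‖a‖ ≤ ‖π a‖ := by
  -- A quasi-state attaining the norm of `a* a`, realized by `(π, x)`, gives `‖π a x‖² = ‖a‖²` with
  -- `‖x‖ ≤ 1`.
  obtain ⟨φ, hφ, h⟩ := exists_isQuasiState_norm_apply (IsSelfAdjoint.star_mul_self a)
  obtain ⟨π, x, hx, hr, -⟩ := hφ.exists_realizes hH
  rw [← hr.norm_sq, Complex.norm_real, CStarRing.norm_star_mul_self, Real.norm_eq_abs, abs_sq,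
    sq] at h
  refine ⟨π, abs_le_of_sq_le_sq ?_ (norm_nonneg _) |>.trans' (le_abs_self _)⟩
  have h1 : ‖π a x‖ ≤ ‖π a‖ := (le_opNorm _ _).trans (mul_le_of_le_one_right (norm_nonneg _) hx)
  rw [sq, sq, ← h]
  exact mul_self_le_mul_self (norm_nonneg _) h1

variable (A H) in
/-- The morphism sending `a` to the field `π ↦ π a`. -/
noncomputable def CStarRep.evalHom : A →⋆ₙₐ[ℂ] (CStarRep A H → (H →L[ℂ] H)) where
  toFun a π := π a
  map_smul' c a := funext fun π => map_smul π c a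
  map_zero' := funext fun π => map_zero π
  map_add' a b := funext fun π => map_add π a b
  map_mul' a b := funext fun π => map_mul π a b
  map_star' a := funext fun π => map_star π a

lemma CStarRep.injective_evalHom (hH : StrictlyContainsCyclicReps A H) :
    Function.Injective (evalHom A H) := by
  refine (injective_iff_map_eq_zero _).2 fun a ha => ?_
  obtain ⟨π, hπ⟩ := exists_norm_le_norm_apply hH a
  have h : π a = 0 := congrFun ha π
  rw [h, norm_zero] at hπ
  exact norm_le_zero_iff.1 hπ

end Takesaki

end

theorem theorem3p7 (A : Type u) [NonUnitalCStarAlgebra A]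
    (H : Type v) [NormedAddCommGroup H] [InnerProductSpace ℂ H] [CompleteSpace H]
    (hH : StrictlyContainsCyclicReps A H) :
    ∃ F : NonUnitalStarSubalgebra ℂ (CStarRep A H → (H →L[ℂ] H)),
      (F : Set (CStarRep A H → (H →L[ℂ] H))) = {T | IsContinuousField T} ∧
      ∃ Φ : A ≃⋆ₐ[ℂ] F,
        (∀ (a : A) (π : CStarRep A H), (Φ a : CStarRep A H → (H →L[ℂ] H)) π = π a) ∧
        ∀ a : A, IsLUB (Set.range fun π : CStarRep A H => ‖(Φ a : CStarRep A H → (H →L[ℂ] H)) π‖) ‖a‖ := by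
  -- Defining `F` as a range makes closure under products automatic; it is not evident from the
  -- definition of a field, as multiplication is not jointly continuous for the WOT in general.
  refine ⟨NonUnitalStarAlgHom.range (CStarRep.evalHom A H), ?_,
    StarAlgEquiv.ofInjective' (CStarRep.evalHom A H) (CStarRep.injective_evalHom hH),
    fun a π => rfl, fun a => ⟨?_, fun M hM => ?_⟩⟩
  · ext T
    constructor
    · rintro ⟨a, rfl⟩
      exact IsContinuousField.eval a
    · intro hT
      obtain ⟨a, ha⟩ := IsContinuousField.exists_eq_eval hT hH
      exact ⟨a, funext fun π => (ha π).symm⟩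
  · rintro _ ⟨π, rfl⟩
    exact NonUnitalStarAlgHom.norm_apply_le π a
  · obtain ⟨π, hπ⟩ := exists_norm_le_norm_apply hH a
    exact hπ.trans (hM ⟨π, rfl⟩)
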